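/- **Theorem (pointwise upper bound).** *Wavelets.* Let $(\psi_{lk})_{l\ge l_0}$ be a Cohen–Daubechies–Vial type orthonormal wavelet basis of $L_2[0,1]$ with $A$ vanishing moments: it is built from a continuous compactly supported Daubechies father/mother pair $(\phi,\psi)$ with $A$ vanishing moments by dyadic dilation and translation in the interior of $[0,1]$, and by dyadic dilation of finitely many continuous, compactly supported edge functions at the two end points. Layer $l_0$ consists of the $2^{l_0+1}$ father functions $\psi_{l_0k}:=\phi_{l_0+1,k}$, and layer $l>l_0$ of $2^l$ wavelets. Put $f_{lk}=\int_0^1 f\psi_{lk}$. Let $2\le p\le\infty$, $1\le q\le\infty$, $0<\alpha<A$, $\nu:=\alpha-1/p>1/2$, $R>0$, and let $\mathcal B^{\alpha,R}_{p,q}$ be the set of $f\in L_2[0,1]$ with $$\Big(\sum_{l\ge l_0}\big(2^{l(\alpha+1/2-1/p)}\|(f_{lk})_k\|_p\big)^q\Big)^{1/q}\le R$$ (supremum over $l$ if $q=\infty$). Every element of $\mathcal B^{\alpha,R}_{p,q}$ has a continuous version, with which it is identified in what follows, and there is a finite $C_{\nu,R}$ with $\|f\|_\infty\le C_{\nu,R}$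 for all $f\in\mathcal B^{\alpha,R}_{p,q}$; fix any such $C_{\nu,R}$. *Model.* Let $n_j\ge1$ and $\varepsilon_j>0$ for $j=1,\dots,m$, and $N=\sum_{j}n_j$. Server $j$ holds $Z^{(j)}=(Y^{(j)}_i,X^{(j)}_i)_{i\le n_j}$, where all $N$ pairs are i.i.d. with $Y=f(X)+\xi$, $X\sim U[0,1]$, and $\xi\sim N(0,1)$ independent of $X$. Let $x_0\in(0,1)$. *Protocol.* Let $D>0$ solve $D^{2\nu+2}=\sum_{j=1}^m (n_j^2\varepsilon_j^2)\wedge(n_jD)$, and put $L=(l_0+1)\vee\lceil\log_2D\rceil$, $\tau=C_{\nu,R}+\sqrt{2(2\nu+1)L}$. With $[y]_\tau=\max(-\tau,\min(\tau,y))$, server $j$ computes $$\hat f^{(j)}_{L,\tau}(x_0)=\sum_{l=l_0}^{L}\sum_k\Big(\frac1{n_j}\sum_{i=1}^{n_j}[Y_i^{(j)}]_\tau\,\psi_{lk}(X_i^{(j)})\Big)\psi_{lk}(x_0)$$ and outputs $T^{(j)}=\hat f^{(j)}_{L,\tau}(x_0)+W^{(j)}$, where the $W^{(j)}$ are independent of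 each other and of the data, and $W^{(j)}$ is centred Laplace with scale $c'_\psi\tau2^L/(n_j\varepsilon_j)$. The central estimator is $\hat f(x_0)=\sum_ju_jT^{(j)}$ with $u_j=v_j/\sum_iv_i$ and $v_j=(n_j^2\varepsilon_j^2)\wedge(n_j2^L)$. *Claim.* There is a constant $c_0>0$ depending only on the wavelet basis such that for every $c'_\psi\ge c_0$: 1. each $T^{(j)}$ is $(\varepsilon_j,0)$-differentially private, hence $(\varepsilon_j,\delta_j)$-differentially private for every $\delta_j\ge0$; 2. for every $d_0>0$ there is a constant $C>0$, depending only on the wavelet basis, $\alpha,p,q,R,C_{\nu,R},c'_\psi$ and $d_0$ (not on $m,n_j,\varepsilon_j,D,x_0$), such that whenever $N\ge2$ and $D\ge d_0$, $$\sup_{f\in\mathcal B^{\alpha,R}_{p,q}}\mathbb E_f\big(\hat f(x_0)-f(x_0)\big)^2\le C\,\log(N)\,2^{-2L\nu}.$$ -/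

import Mathlib

open MeasureTheory ProbabilityTheory
open scoped ENNReal unitInterval

noncomputable section

namespace FedWavelet

/-! ### Daubechies father and mother wavelets -/

/-- `φ`, `ψ` are a continuous Daubechies father / mother wavelet pair with `A` vanishing moments:
`φ` solves the refinement equation of a filter `h` of length `2A`, is supported on `[0, 2A - 1]` and
has orthonormal integer translates, and `ψ`, supported on `[-A + 1, A]`, is the associated wavelet. -/
structure IsDaubechiesPair (A : ℕ) (φ ψ : ℝ → ℝ) : Prop where
  one_le : 1 ≤ A
  continuous_father : Continuous φ
  continuous_mother : Continuous ψ
  support_father : Function.support φ ⊆ Set.Icc 0 (2 * (A : ℝ) - 1)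
  support_mother : Function.support ψ ⊆ Set.Icc (1 - (A : ℝ)) A
  integral_father : ∫ x, φ x = 1
  orthonormal_translates : ∀ k : ℤ, ∫ x, φ x * φ (x - k) = if k = 0 then 1 else 0
  exists_filter : ∃ h : ℤ → ℝ, (∀ k, h k ≠ 0 → 0 ≤ k ∧ k ≤ 2 * (A : ℤ) - 1) ∧
    (∀ x, φ x = √2 * ∑ k ∈ Finset.Icc (0 : ℤ) (2 * A - 1), h k * φ (2 * x - k)) ∧
    (∀ x, ψ x = √2 * ∑ k ∈ Finset.Icc (2 - 2 * (A : ℤ)) 1,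
      (-1 : ℝ) ^ k * h (1 - k) * φ (2 * x - k))
  vanishing_moments : ∀ i < A, ∫ x, x ^ i * ψ x = 0

/-! ### Boundary corrected wavelet bases of `L²[0,1]` -/

/-- The functions from which a boundary corrected wavelet basis of `L²[0,1]` is built: coarsest
level, father and mother wavelet, and the specially constructed functions at the left and at the
right end point. Every edge function is a function of the distance to its end point, so it lives
on `[0, ∞)`; only the indices `k < A` are used. -/
structure WaveletData (A : ℕ) where
  l₀ : ℕ
  father : ℝ → ℝ
  mother : ℝ → ℝ
  fatherLeft : ℕ → ℝ → ℝ
  fatherRight : ℕ → ℝ → ℝ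
  motherLeft : ℕ → ℝ → ℝ
  motherRight : ℕ → ℝ → ℝ

namespace WaveletData

variable {A : ℕ}

/-- Number of basis functions in layer `l`. The layer `l = l₀` holds the `2 ^ (l₀ + 1)` father
functions of resolution `l₀ + 1`, every layer `l > l₀` holds `2 ^ l` wavelets. -/
def width (W : WaveletData A) (l : ℕ) : ℕ := if l = W.l₀ then 2 ^ (W.l₀ + 1) else 2 ^ l

/-- The `k`-th function (`k < 2 ^ l`) at resolution `l`: the first `A` are dilated left edge
functions, the last `A` are dilated right edge functions, and the others are
`2 ^ (l / 2) inner (2 ^ l x - k + s)`. -/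
def dilate (A : ℕ) (left right : ℕ → ℝ → ℝ) (inner : ℝ → ℝ) (s : ℝ) (l k : ℕ) (x : ℝ) : ℝ :=
  (2 : ℝ) ^ ((l : ℝ) / 2) *
    (if k < A then left k (2 ^ l * x)
     else if 2 ^ l ≤ k + A then right (2 ^ l - 1 - k) (2 ^ l * (1 - x))
     else inner (2 ^ l * x - k + s))

/-- The basis function `ψ_{lk}` on `[0,1]`, where `ψ_{l₀ k}` denotes the father function
`φ_{l₀+1, k}`. Since `φ` is supported on `[0, 2A - 1]` and `ψ` on `[-A + 1, A]`, the inner father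
functions are shifted by `A - 1`, so that all inner functions live on
`[2 ^ (-l) (k - A + 1), 2 ^ (-l) (k + A)]`. -/
def fn (W : WaveletData A) (l k : ℕ) (x : I) : ℝ :=
  if l = W.l₀ then dilate A W.fatherLeft W.fatherRight W.father ((A : ℝ) - 1) (W.l₀ + 1) k x
  else dilate A W.motherLeft W.motherRight W.mother 0 l k x

end WaveletData

/-- Cohen-Daubechies-Vial type wavelet bases of `L²[0,1]` with `A` vanishing moments. -/
structure CDVBasis (A : ℕ) extends WaveletData A where
  daubechies : IsDaubechiesPair A father mother
  /-- there is room for the `2A` edge functions at every resolution -/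
  two_mul_le : 2 * A ≤ 2 ^ (l₀ + 1)
  /-- the edge functions are continuous up to the boundary and compactly supported -/
  edge_regular : ∀ g ∈ ({fatherLeft, fatherRight, motherLeft, motherRight} : Set (ℕ → ℝ → ℝ)),
    ∀ k < A, ContinuousOn (g k) (Set.Ici 0) ∧ HasCompactSupport (g k)
  /-- the edge wavelets have `A` vanishing moments -/
  edge_moments : ∀ g ∈ ({motherLeft, motherRight} : Set (ℕ → ℝ → ℝ)),
    ∀ k < A, ∀ i < A, ∫ x in Set.Ici (0 : ℝ), x ^ i * g k x = 0
  /-- the functions `ψ_{lk}`, `l ≥ l₀`, form an orthonormal basis of `L²[0,1]` -/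
  orthonormal_basis :
    ∃ b : HilbertBasis {i : ℕ × ℕ // l₀ ≤ i.1 ∧ i.2 < toWaveletData.width i.1} ℝ
        (Lp ℝ 2 (volume : Measure I)),
      ∀ i, ⇑(b i) =ᵐ[volume] toWaveletData.fn i.1.1 i.1.2

namespace CDVBasis

variable {A : ℕ}

/-! ### Besov balls -/

/-- Wavelet coefficient `f_{lk} = ⟨f, ψ_{lk}⟩`. -/
def coeff (W : CDVBasis A) (f : I → ℝ) (l k : ℕ) : ℝ := ∫ x, f x * W.fn l k x

/-- `2 ^ (l (α + 1/2 - 1/p)) ‖(f_{lk})_k‖_p`, with `1/∞ = 0`. -/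
def levelNorm (W : CDVBasis A) (α : ℝ) (p : ℝ≥0∞) (f : I → ℝ) (l : ℕ) : ℝ :=
  (2 : ℝ) ^ ((l : ℝ) * (α + 1 / 2 - (p⁻¹).toReal)) *
    ‖(WithLp.toLp p (fun k : Fin (W.width l) => W.coeff f l k) :
        PiLp p (fun _ : Fin (W.width l) => ℝ))‖

/-- The Besov norm, as an element of `[0, ∞]`. -/
def besovNorm (W : CDVBasis A) (α : ℝ) (p q : ℝ≥0∞) (f : I → ℝ) : ℝ≥0∞ :=
  if q = ∞ then ⨆ i : ℕ, ENNReal.ofReal (W.levelNorm α p f (W.l₀ + i))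
  else (∑' i : ℕ, ENNReal.ofReal (W.levelNorm α p f (W.l₀ + i)) ^ q.toReal) ^ (1 / q.toReal)

/-- The Besov ball of radius `R`, inside the square integrable functions on `[0,1]`. -/
def besovBall (W : CDVBasis A) (α : ℝ) (p q : ℝ≥0∞) (R : ℝ) : Set (I → ℝ) :=
  {f | MemLp f 2 volume ∧ W.besovNorm α p q f ≤ ENNReal.ofReal R}

end CDVBasis

/-! ### Regression model, differential privacy, Laplace noise -/

/-- One observation `(Y, X)`. -/
abbrev Obs := ℝ × I

/-- The law `P_f` of `(f(X) + ξ, X)` with independent `X ∼ U[0,1]` and `ξ ∼ N(0,1)`. -/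
def regressionLaw (f : I → ℝ) : Measure Obs :=
  ((volume : Measure I).prod (gaussianReal 0 1)).map fun w => (f w.1 + w.2, w.1)

/-- A randomized transcript, given by its conditional law `K z` for every data set `z`,
is `(ε, δ)`-differentially private. -/
def IsDP {Z T : Type*} [DecidableEq Z] [MeasurableSpace T] {n : ℕ}
    (K : (Fin n → Z) → Measure T) (ε δ : ℝ) : Prop :=
  ∀ z z' : Fin n → Z, hammingDist z z' ≤ 1 → ∀ S : Set T, MeasurableSet S →
    K z S ≤ ENNReal.ofReal (Real.exp ε) * K z' S + ENNReal.ofReal δ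

/-- The centred Laplace distribution with scale `b`. -/
def laplace (b : ℝ) : Measure ℝ :=
  (volume : Measure ℝ).withDensity fun x => ENNReal.ofReal (Real.exp (-|x| / b) / (2 * b))

/-- `y` clipped at the threshold `τ`. -/
def clip (τ y : ℝ) : ℝ := if τ < y then τ else if -τ ≤ y then y else -τ

namespace CDVBasis

variable {A : ℕ}

/-! ### The estimator -/

/-- The clipped empirical wavelet coefficient of one server with data `z`. -/
def empCoeff (W : CDVBasis A) (τ : ℝ) {n : ℕ} (z : Fin n → Obs) (l k : ℕ) : ℝ :=
  (1 / (n : ℝ)) * ∑ i, clip τ (z i).1 * W.fn l k (z i).2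

/-- The local estimator of `f(x₀)` of one server with data `z`. -/
def localEst (W : CDVBasis A) (L : ℕ) (τ : ℝ) (x₀ : I) {n : ℕ} (z : Fin n → Obs) : ℝ :=
  ∑ l ∈ Finset.Icc W.l₀ L, ∑ k ∈ Finset.range (W.width l), W.empCoeff τ z l k * W.fn l k x₀

/-- Scale `c τ 2 ^ L / (n ε)` of the Laplace noise of a server. -/
def noiseScale (c τ : ℝ) (L n : ℕ) (ε : ℝ) : ℝ := c * τ * 2 ^ L / (n * ε)

/-- The conditional law, given the data `z` of a server, of its transcript: the local estimator
plus Laplace noise. -/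
def transcriptLaw (W : CDVBasis A) (c : ℝ) (L : ℕ) (τ : ℝ) (x₀ : I) {n : ℕ} (ε : ℝ)
    (z : Fin n → Obs) : Measure ℝ :=
  (laplace (noiseScale c τ L n ε)).map fun w => W.localEst L τ x₀ z + w

/-- `v_j = (n_j² ε_j²) ∧ (n_j 2 ^ L)`. -/
def rawWeight (L n : ℕ) (ε : ℝ) : ℝ := min ((n : ℝ) ^ 2 * ε ^ 2) (n * 2 ^ L)

/-- `u_j = v_j / ∑ v_i`. -/
def weight {m : ℕ} (L : ℕ) (n : Fin m → ℕ) (ε : Fin m → ℝ) (j : Fin m) : ℝ :=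
  rawWeight L (n j) (ε j) / ∑ i, rawWeight L (n i) (ε i)

/-- Joint law of the data and the Laplace noise of all servers: everything is independent, server
`j` holds `n j` observations with law `P_f`. -/
def jointLaw (c : ℝ) (L : ℕ) (τ : ℝ) {m : ℕ} (n : Fin m → ℕ) (ε : Fin m → ℝ) (f : I → ℝ) :
    Measure ((j : Fin m) → (Fin (n j) → Obs) × ℝ) :=
  Measure.pi fun j =>
    (Measure.pi fun _ : Fin (n j) => regressionLaw f).prod (laplace (noiseScale c τ L (n j) (ε j)))

/-- The central estimator `∑ u_j T_j` of `f(x₀)`, with transcripts `T_j` (local estimator plus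
noise). -/
def estimator (W : CDVBasis A) (L : ℕ) (τ : ℝ) (x₀ : I) {m : ℕ} (n : Fin m → ℕ) (ε : Fin m → ℝ)
    (ω : (j : Fin m) → (Fin (n j) → Obs) × ℝ) : ℝ :=
  ∑ j, weight L n ε j * (W.localEst L τ x₀ (ω j).1 + (ω j).2)

/-- The pointwise mean squared error at `x₀`, as an element of `[0, ∞]`. -/
def mse (W : CDVBasis A) (c : ℝ) (L : ℕ) (τ : ℝ) (x₀ : I) {m : ℕ} (n : Fin m → ℕ)
    (ε : Fin m → ℝ) (f : I → ℝ) : ℝ≥0∞ :=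
  ∫⁻ ω, ENNReal.ofReal ((W.estimator L τ x₀ n ε ω - f x₀) ^ 2) ∂(jointLaw c L τ n ε f)

/-- `L = (l₀ + 1) ∨ ⌈log₂ D⌉`. -/
def resolution (W : CDVBasis A) (D : ℝ) : ℕ := max (W.l₀ + 1) ⌈Real.logb 2 D⌉₊

/-- `τ = B + √(2 (2 ν + 1) L)`. -/
def threshold (B ν : ℝ) (L : ℕ) : ℝ := B + √(2 * (2 * ν + 1) * L)

end CDVBasis

end FedWavelet

end

/-!
Privacy and risk of the pooled, clipped and noised wavelet projection estimator.

Everything rests on the localization of the basis, `CDVBasis.exists_sum_abs_fn_le`: the edge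
functions are few and the inner ones are translates of a compactly supported function, so in layer
`l` the absolute values of all basis functions sum to `O(2 ^ (l / 2))` at every point. Hence the
projection kernel `K(x₀, x) = ∑ ψ_{lk}(x) ψ_{lk}(x₀)` over the layers up to `L` is `O(2 ^ L)`
(`CDVBasis.abs_kernel_le`), and by orthonormality `∫ K(x₀, x)² dx = K(x₀, x₀)` is `O(2 ^ L)` as
well. The local estimator is the empirical mean of `clip τ Y * K(x₀, X)`.

*Privacy.* Changing one observation moves the local estimator by `O(τ 2 ^ L / n)`, which the
Laplace noise hides: translating a Laplace density of scale `b` by at most `ε b` changes it by a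
factor of at most `exp ε` (`map_const_add_laplace_le`).

*Bias.* In the Besov ball `|f_{lk}| ≤ R 2 ^ (-l (ν + 1/2))`, as the `ℓ^p` norm dominates the
maximum. So the wavelet series converges uniformly at the rate `2 ^ (-L ν)`; its sum is continuous,
has the coefficients of `f`, and is therefore the continuous version of `f`
(`CDVBasis.ae_eq_series`, `CDVBasis.abs_sum_layer_sub_series_le`). Clipping at `τ = B + t` with
`t² = 2 (2 ν + 1) L` costs a further `O(2 ^ L exp (-t² / 2))`, which is of smaller order
(`abs_integral_clip_add_sub_le`).

*Variance.* A transcript has variance `O(τ² 4 ^ L / v_j)`, where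
`v_j = min (n_j² ε_j²) (n_j 2 ^ L)`, so that the weights `u_j = v_j / ∑ v_i` give the total
`O(τ² 4 ^ L / ∑ v_i)` (`CDVBasis.sum_weight_sq_mul_le`). As `2 ^ L` is comparable with `D` and at
least `D`, the equation for `D` yields `∑ v_i ≥ D ^ (2 ν + 2)`, hence the order
`τ² 2 ^ (-2 L ν)`. Finally `τ² = O(L)`, and `L = O(log N)` since the equation for `D` also forces
`D ≤ N`.
-/

noncomputable section

namespace FedWavelet

/-! ### The Laplace mechanism -/

theorem integral_abs_pow_mul_exp_neg_abs_div (i : ℕ) {b : ℝ} (hb : 0 < b) :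
    ∫ x : ℝ, |x| ^ i * Real.exp (-|x| / b) = 2 * (b ^ (i + 1) * i.factorial) := by
  rw [integral_comp_abs (f := fun x : ℝ => x ^ i * Real.exp (-x / b))]
  have h := Real.integral_rpow_mul_exp_neg_mul_Ioi (a := (i : ℝ) + 1) (r := b⁻¹)
    (by positivity) (inv_pos.2 hb)
  rw [Real.Gamma_nat_eq_factorial, one_div, inv_inv] at h
  rw [show (b : ℝ) ^ (i + 1) = b ^ ((i : ℝ) + 1) by norm_cast, ← h]
  congr 1
  refine setIntegral_congr_fun measurableSet_Ioi (fun x _ => ?_)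
  simp only [add_sub_cancel_right, Real.rpow_natCast]
  congr 2
  field_simp

theorem integrable_abs_pow_mul_exp_neg_abs_div (i : ℕ) {b : ℝ} (hb : 0 < b) :
    Integrable (fun x : ℝ => |x| ^ i * Real.exp (-|x| / b)) := by
  -- a function with non-zero Bochner integral is integrable
  refine Integrable.of_integral_ne_zero ?_
  rw [integral_abs_pow_mul_exp_neg_abs_div i hb]
  positivity

theorem laplaceDensity_nonneg {b : ℝ} (hb : 0 < b) (x : ℝ) :
    0 ≤ Real.exp (-|x| / b) / (2 * b) := by positivity

theorem measurable_laplaceDensity (b : ℝ) :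
    Measurable fun x : ℝ => Real.exp (-|x| / b) / (2 * b) := by fun_prop

theorem isProbabilityMeasure_laplace {b : ℝ} (hb : 0 < b) : IsProbabilityMeasure (laplace b) := by
  constructor
  have hi := integrable_abs_pow_mul_exp_neg_abs_div 0 hb
  have h := integral_abs_pow_mul_exp_neg_abs_div 0 hb
  simp only [pow_zero, one_mul, zero_add, pow_one, Nat.factorial_zero, Nat.cast_one, mul_one]
    at hi h
  rw [laplace, withDensity_apply _ MeasurableSet.univ, Measure.restrict_univ,
    ← ofReal_integral_eq_lintegral_ofReal (hi.div_const _)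
      (Filter.Eventually.of_forall (laplaceDensity_nonneg hb)), integral_div, h,
    div_self (by positivity), ENNReal.ofReal_one]

theorem integral_laplace {b : ℝ} (hb : 0 < b) (f : ℝ → ℝ) :
    ∫ x, f x ∂(laplace b) = ∫ x, Real.exp (-|x| / b) / (2 * b) * f x := by
  rw [laplace, integral_withDensity_eq_integral_toReal_smul
    (measurable_laplaceDensity b).ennreal_ofReal (Filter.Eventually.of_forall fun _ => by simp)]
  simp_rw [ENNReal.toReal_ofReal (laplaceDensity_nonneg hb _), smul_eq_mul]

theorem memLp_id_laplace {b : ℝ} (hb : 0 < b) : MemLp (fun x : ℝ => x) 2 (laplace b) := by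
  rw [memLp_two_iff_integrable_sq measurable_id'.aestronglyMeasurable, laplace,
    integrable_withDensity_iff_integrable_smul'
      (measurable_laplaceDensity b).ennreal_ofReal (Filter.Eventually.of_forall fun _ => by simp)]
  refine ((integrable_abs_pow_mul_exp_neg_abs_div 2 hb).div_const (2 * b)).congr
    (Filter.Eventually.of_forall fun x => ?_)
  simp only [ENNReal.toReal_ofReal (laplaceDensity_nonneg hb _), smul_eq_mul, sq_abs]
  ring

theorem integral_id_laplace {b : ℝ} (hb : 0 < b) : ∫ x, x ∂(laplace b) = 0 := by
  rw [integral_laplace hb]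
  have h := integral_neg_eq_self (fun x : ℝ => Real.exp (-|x| / b) / (2 * b) * x) volume
  simp only [abs_neg, mul_neg, integral_neg] at h
  linarith

theorem variance_id_laplace {b : ℝ} (hb : 0 < b) : Var[fun x : ℝ => x; laplace b] = 2 * b ^ 2 := by
  have := isProbabilityMeasure_laplace hb
  rw [variance_of_integral_eq_zero measurable_id'.aemeasurable (integral_id_laplace hb),
    integral_laplace hb]
  have h := integral_abs_pow_mul_exp_neg_abs_div 2 hb
  calc ∫ x, Real.exp (-|x| / b) / (2 * b) * x ^ 2
      = ∫ x, (|x| ^ 2 * Real.exp (-|x| / b)) / (2 * b) := by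
        congr 1; ext x; rw [sq_abs]; ring
    _ = _ := by
        rw [integral_div, h]
        simp [Nat.factorial]
        field_simp

theorem map_const_add_laplace_apply (b a : ℝ) {S : Set ℝ} (hS : MeasurableSet S) :
    (laplace b).map (fun w => a + w) S =
      ∫⁻ y in S, ENNReal.ofReal (Real.exp (-|y - a| / b) / (2 * b)) := by
  rw [Measure.map_apply (measurable_const_add a) hS, laplace,
    withDensity_apply _ (measurable_const_add a hS),
    ← lintegral_indicator (measurable_const_add a hS), ← lintegral_indicator hS,
    ← lintegral_add_left_eq_self (S.indicator _) a]
  refine lintegral_congr fun x => ?_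
  simp only [Set.indicator, Set.mem_preimage, add_sub_cancel_left]
  rfl

/-- Two Laplace laws of the same scale with close centres have densities within a factor
`exp ε` of one another. -/
theorem map_const_add_laplace_le {b ε a a' : ℝ} (hb : 0 < b) (h : |a - a'| ≤ ε * b) {S : Set ℝ}
    (hS : MeasurableSet S) :
    (laplace b).map (fun w => a + w) S ≤
      ENNReal.ofReal (Real.exp ε) * (laplace b).map (fun w => a' + w) S := by
  rw [map_const_add_laplace_apply b a hS, map_const_add_laplace_apply b a' hS,
    ← lintegral_const_mul' _ _ ENNReal.ofReal_ne_top]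
  refine lintegral_mono fun y => ?_
  rw [← ENNReal.ofReal_mul (Real.exp_pos _).le, ← mul_div_assoc, ← Real.exp_add]
  refine ENNReal.ofReal_le_ofReal ?_
  gcongr
  rw [← sub_le_iff_le_add, ← sub_div, div_le_iff₀ hb]
  have := abs_sub_abs_le_abs_sub (y - a') (y - a)
  rw [sub_sub_sub_cancel_left] at this
  linarith

/-! ### Clipping and Gaussian noise -/

theorem abs_clip_le {τ : ℝ} (hτ : 0 ≤ τ) (y : ℝ) : |clip τ y| ≤ τ := by
  unfold clip
  split_ifs <;> rw [abs_le] <;> constructor <;> linarith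

theorem measurable_clip (τ : ℝ) : Measurable (clip τ) := by
  unfold clip
  exact Measurable.ite measurableSet_Ioi measurable_const
    (Measurable.ite measurableSet_Ici measurable_id measurable_const)

/-- The clipping error is at most the tail `(|x| - t)₊`, hence at most `exp (s (|x| - t))` with
`s = t`, the rate that minimizes the Gaussian mean `exp (s ^ 2 / 2 - s t)` of `exp (s (x - t))`. -/
theorem abs_clip_add_sub_le {B t y : ℝ} (ht : 1 ≤ t) (hy : |y| ≤ B) (x : ℝ) :
    |clip (B + t) (y + x) - (y + x)| ≤
      Real.exp (-t ^ 2) * (Real.exp (t * x) + Real.exp (-t * x)) := by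
  have h₁ : |clip (B + t) (y + x) - (y + x)| ≤ max 0 (|x| - t) := by
    have := abs_le.1 hy
    unfold clip
    split_ifs with h h'
    · rw [abs_sub_comm, abs_of_pos (by linarith)]
      exact le_max_of_le_right (by linarith [le_abs_self x])
    · simp
    · rw [abs_of_pos (by linarith)]
      exact le_max_of_le_right (by linarith [neg_abs_le x])
  have h₂ : max 0 (|x| - t) ≤ Real.exp (t * (|x| - t)) := by
    refine max_le (Real.exp_pos _).le ?_
    rcases le_or_gt (|x| - t) 0 with h | h
    · exact h.trans (Real.exp_pos _).le
    · nlinarith [Real.add_one_le_exp (t * (|x| - t))]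
  refine h₁.trans (h₂.trans ?_)
  rw [show t * (|x| - t) = -t ^ 2 + t * |x| by ring, Real.exp_add]
  gcongr
  rcases abs_cases x with ⟨h, _⟩ | ⟨h, _⟩ <;> rw [h]
  · linarith [Real.exp_pos (-t * x)]
  · rw [mul_neg, ← neg_mul]; linarith [Real.exp_pos (t * x)]

theorem integrable_clip_add {τ : ℝ} (hτ : 0 ≤ τ) (y : ℝ) :
    Integrable (fun x => clip τ (y + x)) (gaussianReal 0 1) :=
  Integrable.of_bound ((measurable_clip τ).comp (measurable_const_add y)).aestronglyMeasurable
    τ (Filter.Eventually.of_forall fun _ => abs_clip_le hτ _)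

/-- Clipping at height `t` above the range of the regression function costs a bias of order
`exp (-t ^ 2 / 2)`. -/
theorem abs_integral_clip_add_sub_le {B t y : ℝ} (ht : 1 ≤ t) (hy : |y| ≤ B) :
    |(∫ x, clip (B + t) (y + x) ∂(gaussianReal 0 1)) - y| ≤ 2 * Real.exp (-(t ^ 2 / 2)) := by
  have hB : 0 ≤ B := (abs_nonneg y).trans hy
  have hid : Integrable (fun x : ℝ => x) (gaussianReal 0 1) :=
    (memLp_id_gaussianReal 1).integrable le_rfl
  have hy' : Integrable (fun x : ℝ => y + x) (gaussianReal 0 1) := (integrable_const y).add hid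
  have hc := integrable_clip_add (τ := B + t) (by linarith) y
  have hm : ∀ s : ℝ, ∫ x, Real.exp (s * x) ∂(gaussianReal 0 1) = Real.exp (s ^ 2 / 2) := by
    intro s
    have := congrFun (mgf_fun_id_gaussianReal (μ := 0) (v := 1)) s
    simpa [mgf] using this
  have hmean : ∫ x, (y + x) ∂(gaussianReal 0 1) = y := by
    rw [integral_add (integrable_const y) hid, integral_id_gaussianReal]; simp
  have he := integrable_exp_mul_gaussianReal (μ := 0) (v := 1)
  calc |(∫ x, clip (B + t) (y + x) ∂(gaussianReal 0 1)) - y|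
      = |∫ x, (clip (B + t) (y + x) - (y + x)) ∂(gaussianReal 0 1)| := by
        rw [integral_sub hc hy', hmean]
    _ ≤ ∫ x, |clip (B + t) (y + x) - (y + x)| ∂(gaussianReal 0 1) := abs_integral_le_integral_abs
    _ ≤ ∫ x, Real.exp (-t ^ 2) * (Real.exp (t * x) + Real.exp (-t * x)) ∂(gaussianReal 0 1) :=
        integral_mono (hc.sub hy').abs (((he t).add (he (-t))).const_mul _)
          (abs_clip_add_sub_le ht hy)
    _ = 2 * Real.exp (-(t ^ 2 / 2)) := by
        rw [integral_const_mul, integral_add (he t) (he (-t)), hm, hm, neg_sq, ← two_mul,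
          mul_left_comm, ← Real.exp_add]
        congr 2; ring

/-! ### Localization of the wavelet basis -/

theorem eventually_abs_le_of_continuousOn_Ici {g : ℝ → ℝ} (hg : ContinuousOn g (Set.Ici 0))
    (hc : HasCompactSupport g) : ∀ᶠ M : ℝ in Filter.atTop, ∀ t, 0 ≤ t → |g t| ≤ M := by
  obtain ⟨C, hC⟩ := (hc.isCompact.inter_right isClosed_Ici).exists_bound_of_continuousOn
    (hg.mono Set.inter_subset_right)
  filter_upwards [Filter.eventually_ge_atTop C, Filter.eventually_ge_atTop 0] with M hM hM₀ t ht
  by_cases h : t ∈ tsupport g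
  · exact (hC t ⟨h, ht⟩).trans hM
  · rwa [image_eq_zero_of_notMem_tsupport h, abs_zero]

theorem eventually_abs_le_of_support_subset_Icc {g : ℝ → ℝ} (hg : Continuous g) {a b : ℝ}
    (hs : Function.support g ⊆ Set.Icc a b) : ∀ᶠ M : ℝ in Filter.atTop, ∀ t, |g t| ≤ M := by
  obtain ⟨C, hC⟩ := hg.bounded_above_of_compact_support
    (HasCompactSupport.of_support_subset_isCompact isCompact_Icc hs)
  filter_upwards [Filter.eventually_ge_atTop C] with M hM t using (hC t).trans hM

theorem card_le_of_abs_sub_le {s : Finset ℕ} {u r : ℝ} (hr : 0 ≤ r)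
    (h : ∀ k ∈ s, |u - k| ≤ r) : (s.card : ℝ) ≤ 2 * r + 1 := by
  have hsub : s.map Nat.castEmbedding ⊆ Finset.Icc ⌈u - r⌉ ⌊u + r⌋ := by
    intro z hz
    obtain ⟨k, hk, rfl⟩ := Finset.mem_map.1 hz
    have := abs_le.1 (h k hk)
    simp only [Nat.castEmbedding_apply, Finset.mem_Icc, Int.ceil_le, Int.le_floor, Int.cast_natCast]
    constructor <;> linarith
  have hc := Finset.card_le_card hsub
  rw [Finset.card_map, Int.card_Icc] at hc
  rcases le_or_gt (⌊u + r⌋ + 1 - ⌈u - r⌉) 0 with h0 | h0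
  · rw [Int.toNat_eq_zero.2 h0, Nat.le_zero] at hc
    rw [hc]; push_cast; linarith
  · have h1 : (s.card : ℤ) ≤ ⌊u + r⌋ + 1 - ⌈u - r⌉ := by omega
    have h2 : (s.card : ℝ) ≤ ⌊u + r⌋ + 1 - ⌈u - r⌉ := by exact_mod_cast h1
    linarith [Int.floor_le (u + r), Int.le_ceil (u - r)]

namespace WaveletData

/-- At each point of `[0,1]` at most `6 A + 1` functions of resolution `l` are non-zero: the `2 A`
edge functions and those translates of `inner` whose support contains the point. -/
theorem sum_abs_dilate_le {A : ℕ} {left right : ℕ → ℝ → ℝ} {inner : ℝ → ℝ} {M : ℝ} (hM : 0 ≤ M)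
    (hA : 1 ≤ A) (hleft : ∀ k < A, ∀ t, 0 ≤ t → |left k t| ≤ M)
    (hright : ∀ k < A, ∀ t, 0 ≤ t → |right k t| ≤ M) (hinner : ∀ t, |inner t| ≤ M)
    (hsupp : ∀ t, inner t ≠ 0 → |t| ≤ 2 * A) (s : ℝ) (l : ℕ) (x : I) :
    ∑ k ∈ Finset.range (2 ^ l), |dilate A left right inner s l k x| ≤
      (6 * A + 1) * M * (2 : ℝ) ^ ((l : ℝ) / 2) := by
  have hx := x.2
  have hbound : ∀ k ∈ Finset.range (2 ^ l), |dilate A left right inner s l k x| ≤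
      (2 : ℝ) ^ ((l : ℝ) / 2) * M * ((if k < A then 1 else 0) + (if 2 ^ l ≤ k + A then 1 else 0)
        + (if |2 ^ l * (x : ℝ) + s - k| ≤ 2 * A then 1 else 0)) := by
    intro k _
    rw [dilate, abs_mul, abs_of_nonneg (by positivity), mul_assoc]
    refine mul_le_mul_of_nonneg_left ?_ (by positivity)
    split_ifs with h1 h2 h3 h3 h2 h3 h3 <;>
      first
      | (have := hleft k h1 (2 ^ l * (x : ℝ)) (by have := hx.1; positivity); linarith)
      | (have := hright (2 ^ l - 1 - k) (by omega) (2 ^ l * (1 - (x : ℝ)))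
          (mul_nonneg (by positivity) (by linarith [hx.2])); linarith)
      | (have := hinner (2 ^ l * (x : ℝ) - k + s); linarith)
      | (have : inner (2 ^ l * (x : ℝ) - k + s) = 0 := by
          by_contra h0
          exact h3 (by have := hsupp _ h0; rwa [sub_add_eq_add_sub] at this)
         simp [this])
  refine (Finset.sum_le_sum hbound).trans ?_
  rw [← Finset.mul_sum, Finset.sum_add_distrib, Finset.sum_add_distrib, Finset.sum_boole,
    Finset.sum_boole, Finset.sum_boole]
  have c1 : (((Finset.range (2 ^ l)).filter (· < A)).card : ℝ) ≤ A := by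
    have : (Finset.range (2 ^ l)).filter (· < A) ⊆ Finset.range A := fun k hk =>
      Finset.mem_range.2 (Finset.mem_filter.1 hk).2
    exact_mod_cast (Finset.card_le_card this).trans (Finset.card_range A).le
  have c2 : (((Finset.range (2 ^ l)).filter (2 ^ l ≤ · + A)).card : ℝ) ≤ A := by
    have : (Finset.range (2 ^ l)).filter (2 ^ l ≤ · + A) ⊆ Finset.Ico (2 ^ l - A) (2 ^ l) := by
      intro k hk
      rw [Finset.mem_filter, Finset.mem_range] at hk
      exact Finset.mem_Ico.2 ⟨by omega, hk.1⟩
    have h2 := Finset.card_le_card this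
    rw [Nat.card_Ico] at h2
    exact_mod_cast h2.trans (by omega)
  have c3 := card_le_of_abs_sub_le (s := (Finset.range (2 ^ l)).filter
    fun k : ℕ => |2 ^ l * (x : ℝ) + s - k| ≤ 2 * A) (u := 2 ^ l * (x : ℝ) + s) (r := 2 * A)
    (by positivity) (fun k hk => (Finset.mem_filter.1 hk).2)
  calc _ ≤ (2 : ℝ) ^ ((l : ℝ) / 2) * M * (A + A + (2 * (2 * A) + 1)) := by gcongr
    _ = _ := by ring

theorem continuous_dilate {A : ℕ} {left right : ℕ → ℝ → ℝ} {inner : ℝ → ℝ}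
    (hA : 1 ≤ A) (hleft : ∀ k < A, ContinuousOn (left k) (Set.Ici 0))
    (hright : ∀ k < A, ContinuousOn (right k) (Set.Ici 0)) (hinner : Continuous inner)
    (s : ℝ) (l k : ℕ) : Continuous fun x : I => dilate A left right inner s l k x := by
  unfold dilate
  refine continuous_const.mul ?_
  split_ifs with h1 h2
  · exact (hleft k h1).comp_continuous (by fun_prop) fun x =>
      mul_nonneg (a := (2 : ℝ) ^ l) (by positivity) x.2.1
  · exact (hright _ (by omega)).comp_continuous (by fun_prop) fun x =>
      mul_nonneg (a := (2 : ℝ) ^ l) (by positivity) (sub_nonneg.2 x.2.2)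
  · exact hinner.comp (by fun_prop)

end WaveletData

namespace CDVBasis

variable {A : ℕ}

theorem continuous_fn (W : CDVBasis A) (l k : ℕ) : Continuous (W.fn l k) := by
  have hA := W.daubechies.one_le
  unfold WaveletData.fn
  split_ifs
  · exact WaveletData.continuous_dilate hA (fun k hk => (W.edge_regular _ (by simp) k hk).1)
      (fun k hk => (W.edge_regular _ (by simp) k hk).1) W.daubechies.continuous_father _ _ _
  · exact WaveletData.continuous_dilate hA (fun k hk => (W.edge_regular _ (by simp) k hk).1)
      (fun k hk => (W.edge_regular _ (by simp) k hk).1) W.daubechies.continuous_mother _ _ _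

/-- The localization of the basis: in each layer the functions have absolute sum of the order
`2 ^ (l / 2)` of a single one of them. -/
theorem exists_sum_abs_fn_le (W : CDVBasis A) : ∃ M : ℝ, 0 < M ∧ ∀ (l : ℕ) (x : I),
    ∑ k ∈ Finset.range (W.width l), |W.fn l k x| ≤ M * (2 : ℝ) ^ ((l : ℝ) / 2) := by
  have hA := W.daubechies.one_le
  have hA' : (1 : ℝ) ≤ A := by exact_mod_cast hA
  have hedge : ∀ᶠ M : ℝ in Filter.atTop, ∀ g ∈ ({W.fatherLeft, W.fatherRight, W.motherLeft,
      W.motherRight} : Set (ℕ → ℝ → ℝ)), ∀ k ∈ Finset.range A, ∀ t, 0 ≤ t → |g k t| ≤ M := by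
    rw [Filter.eventually_all_finite (Set.toFinite _)]
    intro g hg
    rw [Filter.eventually_all_finset]
    intro k hk
    obtain ⟨h1, h2⟩ := W.edge_regular g hg k (Finset.mem_range.1 hk)
    exact eventually_abs_le_of_continuousOn_Ici h1 h2
  obtain ⟨M, hM, hMe, hMf, hMm⟩ := ((Filter.eventually_gt_atTop 0).and (hedge.and
    ((eventually_abs_le_of_support_subset_Icc W.daubechies.continuous_father
      W.daubechies.support_father).and
    (eventually_abs_le_of_support_subset_Icc W.daubechies.continuous_mother
      W.daubechies.support_mother)))).exists
  -- the factor `2` pays for layer `l₀`, whose functions have resolution `l₀ + 1`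
  refine ⟨2 * ((6 * A + 1) * M), by positivity, fun l x => ?_⟩
  unfold WaveletData.width WaveletData.fn
  split_ifs with h
  · subst h
    refine (WaveletData.sum_abs_dilate_le hM.le hA
      (fun k hk => hMe _ (by simp) k (Finset.mem_range.2 hk))
      (fun k hk => hMe _ (by simp) k (Finset.mem_range.2 hk)) hMf (fun t ht => ?_) _ _ x).trans ?_
    · have := W.daubechies.support_father ht
      exact abs_le.2 ⟨by linarith [this.1], by linarith [this.2]⟩
    · rw [mul_comm 2, mul_assoc ((6 * (A : ℝ) + 1) * M) 2]
      refine mul_le_mul_of_nonneg_left ?_ (by positivity)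
      rw [← Real.rpow_one_add' (by norm_num) (by positivity)]
      refine Real.rpow_le_rpow_of_exponent_le (by norm_num) ?_
      push_cast; linarith
  · refine (WaveletData.sum_abs_dilate_le hM.le hA
      (fun k hk => hMe _ (by simp) k (Finset.mem_range.2 hk))
      (fun k hk => hMe _ (by simp) k (Finset.mem_range.2 hk)) hMm (fun t ht => ?_) _ _ x).trans ?_
    · have := W.daubechies.support_mother ht
      exact abs_le.2 ⟨by linarith [this.1], by linarith [this.2]⟩
    · refine mul_le_mul_of_nonneg_right ?_ (by positivity)
      have : 0 ≤ (6 * (A : ℝ) + 1) * M := by positivity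
      linarith

/-! ### Orthonormality and the projection kernel -/

theorem integral_fn_mul_fn (W : CDVBasis A) {l k l' k' : ℕ} (hl : W.l₀ ≤ l) (hk : k < W.width l)
    (hl' : W.l₀ ≤ l') (hk' : k' < W.width l') :
    ∫ x, W.fn l k x * W.fn l' k' x = if l = l' ∧ k = k' then 1 else 0 := by
  obtain ⟨b, hb⟩ := W.orthonormal_basis
  have h := (orthonormal_iff_ite.1 b.orthonormal) ⟨(l, k), hl, hk⟩ ⟨(l', k'), hl', hk'⟩
  rw [L2.inner_def] at h
  simp only [Subtype.mk.injEq, Prod.mk.injEq] at h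
  rw [← h]
  refine integral_congr_ae ?_
  filter_upwards [hb ⟨(l, k), hl, hk⟩, hb ⟨(l', k'), hl', hk'⟩] with x h1 h2
  simp only [h1, h2, RCLike.inner_apply, conj_trivial]
  simp [mul_comm]

/-- A function is determined by its wavelet coefficients. -/
theorem ae_eq_of_coeff_eq (W : CDVBasis A) {f g : I → ℝ} (hf : MemLp f 2) (hg : MemLp g 2)
    (h : ∀ l k, W.l₀ ≤ l → k < W.width l → W.coeff f l k = W.coeff g l k) : f =ᵐ[volume] g := by
  obtain ⟨b, hb⟩ := W.orthonormal_basis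
  have key : ∀ {u : I → ℝ} (hu : MemLp u 2) (i),
      b.repr (hu.toLp u) i = W.coeff u i.1.1 i.1.2 := by
    intro u hu i
    rw [b.repr_apply_apply, L2.inner_def, coeff]
    refine integral_congr_ae ?_
    filter_upwards [hb i, hu.coeFn_toLp] with x h1 h2
    simp [h1, h2]
  have heq : hf.toLp f = hg.toLp g := by
    refine b.repr.injective ?_
    ext i
    rw [key, key, h _ _ i.2.1 i.2.2]
  exact (hf.toLp_eq_toLp_iff hg).1 heq

/-- The kernel `∑ ψ_{lk}(x) ψ_{lk}(x₀)` of the orthogonal projection onto the layers up to `L`. -/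
def kernel (W : CDVBasis A) (L : ℕ) (x₀ x : I) : ℝ :=
  ∑ l ∈ Finset.Icc W.l₀ L, ∑ k ∈ Finset.range (W.width l), W.fn l k x * W.fn l k x₀

theorem continuous_kernel (W : CDVBasis A) (L : ℕ) (x₀ : I) : Continuous (W.kernel L x₀) := by
  unfold kernel
  exact continuous_finsetSum _ fun l _ => continuous_finsetSum _ fun k _ =>
    (W.continuous_fn l k).mul continuous_const

theorem localEst_eq (W : CDVBasis A) (L : ℕ) (τ : ℝ) (x₀ : I) {n : ℕ} (z : Fin n → Obs) :
    W.localEst L τ x₀ z = 1 / (n : ℝ) * ∑ i, clip τ (z i).1 * W.kernel L x₀ (z i).2 := by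
  simp only [localEst, empCoeff, kernel, Finset.mul_sum, Finset.sum_mul]
  symm
  rw [Finset.sum_comm]
  refine Finset.sum_congr rfl fun l _ => ?_
  rw [Finset.sum_comm]
  exact Finset.sum_congr rfl fun k _ => Finset.sum_congr rfl fun i _ => by ring

theorem sum_two_pow_Icc_le (a L : ℕ) : ∑ l ∈ Finset.Icc a L, (2 : ℝ) ^ l ≤ 2 * 2 ^ L := by
  calc ∑ l ∈ Finset.Icc a L, (2 : ℝ) ^ l ≤ ∑ l ∈ Finset.range (L + 1), (2 : ℝ) ^ l :=
        Finset.sum_le_sum_of_subset_of_nonneg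
          (fun l hl => Finset.mem_range.2 (by have := (Finset.mem_Icc.1 hl).2; omega))
          fun _ _ _ => by positivity
    _ ≤ 2 * 2 ^ L := by
        rw [geom_sum_eq (by norm_num)]
        have : (0 : ℝ) < 2 ^ L := by positivity
        rw [pow_succ]; norm_num; linarith

theorem abs_kernel_le (W : CDVBasis A) {M : ℝ}
    (hM : ∀ (l : ℕ) (x : I),
      ∑ k ∈ Finset.range (W.width l), |W.fn l k x| ≤ M * (2 : ℝ) ^ ((l : ℝ) / 2))
    (L : ℕ) (x₀ x : I) : |W.kernel L x₀ x| ≤ 2 * M ^ 2 * 2 ^ L := by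
  have hlayer : ∀ l, ∑ k ∈ Finset.range (W.width l), |W.fn l k x * W.fn l k x₀| ≤
      M ^ 2 * 2 ^ l := by
    intro l
    have hpow : (2 : ℝ) ^ ((l : ℝ) / 2) * (2 : ℝ) ^ ((l : ℝ) / 2) = 2 ^ l := by
      rw [← Real.rpow_add (by norm_num), add_halves, Real.rpow_natCast]
    calc ∑ k ∈ Finset.range (W.width l), |W.fn l k x * W.fn l k x₀|
        ≤ ∑ k ∈ Finset.range (W.width l), |W.fn l k x| * (M * (2 : ℝ) ^ ((l : ℝ) / 2)) := by
          refine Finset.sum_le_sum fun k hk => ?_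
          rw [abs_mul]
          refine mul_le_mul_of_nonneg_left ?_ (abs_nonneg _)
          exact (Finset.single_le_sum (f := fun k => |W.fn l k x₀|)
            (fun _ _ => abs_nonneg _) hk).trans (hM l x₀)
      _ ≤ (M * (2 : ℝ) ^ ((l : ℝ) / 2)) * (M * (2 : ℝ) ^ ((l : ℝ) / 2)) := by
          rw [← Finset.sum_mul]
          exact mul_le_mul_of_nonneg_right (hM l x)
            ((Finset.sum_nonneg fun _ _ => abs_nonneg _).trans (hM l x))
      _ = M ^ 2 * 2 ^ l := by rw [← hpow]; ring
  calc |W.kernel L x₀ x|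
      ≤ ∑ l ∈ Finset.Icc W.l₀ L, ∑ k ∈ Finset.range (W.width l), |W.fn l k x * W.fn l k x₀| :=
        (Finset.abs_sum_le_sum_abs _ _).trans
          (Finset.sum_le_sum fun l _ => Finset.abs_sum_le_sum_abs _ _)
    _ ≤ ∑ l ∈ Finset.Icc W.l₀ L, M ^ 2 * 2 ^ l := Finset.sum_le_sum fun l _ => hlayer l
    _ ≤ 2 * M ^ 2 * 2 ^ L := by
        rw [← Finset.mul_sum]
        nlinarith [sum_two_pow_Icc_le W.l₀ L, sq_nonneg M]

theorem integral_mul_kernel (W : CDVBasis A) (L : ℕ) (x₀ : I) {f : I → ℝ}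
    (hf : Integrable f) :
    ∫ x, f x * W.kernel L x₀ x =
      ∑ l ∈ Finset.Icc W.l₀ L, ∑ k ∈ Finset.range (W.width l), W.coeff f l k * W.fn l k x₀ := by
  have hint : ∀ l k, Integrable fun x => f x * (W.fn l k x * W.fn l k x₀) := by
    intro l k
    simp_rw [← mul_assoc]
    refine Integrable.mul_const ?_ _
    obtain ⟨C, hC⟩ := isCompact_univ.exists_bound_of_continuousOn (W.continuous_fn l k).continuousOn
    exact hf.mul_bdd (c := C) (W.continuous_fn l k).aestronglyMeasurable
      (Filter.Eventually.of_forall fun x => hC x trivial)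
  simp only [kernel, Finset.mul_sum]
  rw [integral_finsetSum _ fun l _ => integrable_finsetSum _ fun k _ => hint l k]
  refine Finset.sum_congr rfl fun l _ => ?_
  rw [integral_finsetSum _ fun k _ => hint l k]
  refine Finset.sum_congr rfl fun k _ => ?_
  simp_rw [← mul_assoc, integral_mul_const, coeff]

theorem integrable_of_continuous {f : I → ℝ} (hf : Continuous f) : Integrable f :=
  hf.integrable_of_hasCompactSupport (HasCompactSupport.of_compactSpace f)

/-- The kernel reproduces the basis functions of the layers up to `L`. -/
theorem coeff_kernel (W : CDVBasis A) (L : ℕ) (x₀ : I) {l k : ℕ} (hl : l ∈ Finset.Icc W.l₀ L)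
    (hk : k ∈ Finset.range (W.width l)) : W.coeff (W.kernel L x₀) l k = W.fn l k x₀ := by
  have h := W.integral_mul_kernel L x₀ (integrable_of_continuous (W.continuous_fn l k))
  simp only [coeff, mul_comm (W.kernel L x₀ _)] at h ⊢
  rw [h, Finset.sum_eq_single_of_mem l hl, Finset.sum_eq_single_of_mem k hk]
  · rw [W.integral_fn_mul_fn (Finset.mem_Icc.1 hl).1 (Finset.mem_range.1 hk)
      (Finset.mem_Icc.1 hl).1 (Finset.mem_range.1 hk)]
    simp
  · intro k' hk' hne
    rw [W.integral_fn_mul_fn (Finset.mem_Icc.1 hl).1 (Finset.mem_range.1 hk)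
      (Finset.mem_Icc.1 hl).1 (Finset.mem_range.1 hk')]
    simp [hne.symm]
  · intro l' hl' hne
    refine Finset.sum_eq_zero fun k' hk' => ?_
    rw [W.integral_fn_mul_fn (Finset.mem_Icc.1 hl).1 (Finset.mem_range.1 hk)
      (Finset.mem_Icc.1 hl').1 (Finset.mem_range.1 hk')]
    simp [hne.symm]

theorem integral_kernel_sq (W : CDVBasis A) (L : ℕ) (x₀ : I) :
    ∫ x, W.kernel L x₀ x ^ 2 = W.kernel L x₀ x₀ := by
  simp_rw [sq]
  rw [W.integral_mul_kernel L x₀ (integrable_of_continuous (W.continuous_kernel L x₀)), kernel]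
  exact Finset.sum_congr rfl fun l hl => Finset.sum_congr rfl fun k hk => by
    rw [W.coeff_kernel L x₀ hl hk]

/-! ### Wavelet series of functions in a Besov ball -/

theorem levelNorm_le (W : CDVBasis A) {α R : ℝ} {p q : ℝ≥0∞} (hq : 1 ≤ q) (hR : 0 ≤ R) {f : I → ℝ}
    (hf : f ∈ W.besovBall α p q R) (i : ℕ) : W.levelNorm α p f (W.l₀ + i) ≤ R := by
  have h := hf.2
  rw [← ENNReal.ofReal_le_ofReal_iff hR]
  refine le_trans ?_ h
  unfold besovNorm
  split_ifs with hq'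
  · exact le_iSup (fun i : ℕ => ENNReal.ofReal (W.levelNorm α p f (W.l₀ + i))) i
  · have hpos : 0 < q.toReal := ENNReal.toReal_pos (by rintro rfl; simp at hq) hq'
    rw [one_div, ENNReal.le_rpow_inv_iff hpos]
    exact ENNReal.le_tsum
      (f := fun i : ℕ => ENNReal.ofReal (W.levelNorm α p f (W.l₀ + i)) ^ q.toReal) i

/-- All coefficients of layer `l` of a function in the Besov ball are at most
`R * 2 ^ (-l / 2) * r ^ l`, where `r = 2 ^ (-ν)`. -/
theorem abs_coeff_le (W : CDVBasis A) {α ν R : ℝ} {p q : ℝ≥0∞} (hp : 1 ≤ p) (hq : 1 ≤ q)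
    (hν : ν = α - (p⁻¹).toReal) (hR : 0 ≤ R) {f : I → ℝ} (hf : f ∈ W.besovBall α p q R) (i : ℕ)
    {k : ℕ} (hk : k < W.width (W.l₀ + i)) :
    |W.coeff f (W.l₀ + i) k| * (2 : ℝ) ^ (((W.l₀ + i : ℕ) : ℝ) / 2) ≤
      R * ((2 : ℝ) ^ (-ν)) ^ (W.l₀ + i) := by
  have : Fact (1 ≤ p) := ⟨hp⟩
  have h := W.levelNorm_le hq hR hf i
  have h2 := PiLp.norm_apply_le (WithLp.toLp p (fun k : Fin (W.width (W.l₀ + i)) =>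
    W.coeff f (W.l₀ + i) k) : PiLp p (fun _ : Fin (W.width (W.l₀ + i)) => ℝ)) ⟨k, hk⟩
  simp only [Real.norm_eq_abs] at h2
  -- the `ℓ^p` norm of the layer dominates each coefficient
  have hexp : α + 1 / 2 - (p⁻¹).toReal = ν + 1 / 2 := by rw [hν]; ring
  rw [levelNorm, hexp] at h
  generalize W.l₀ + i = l at *
  have h3 := (mul_le_mul_of_nonneg_left h2 (by positivity)).trans h
  rw [← Real.rpow_natCast, ← Real.rpow_mul (by norm_num)]
  have hs : (2 : ℝ) ^ ((l : ℝ) / 2) = (2 : ℝ) ^ ((l : ℝ) * (ν + 1 / 2)) * (2 : ℝ) ^ (-ν * l) := by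
    rw [← Real.rpow_add (by norm_num)]; congr 1; ring
  rw [hs, ← mul_assoc, mul_comm |_|]
  exact mul_le_mul_of_nonneg_right h3 (by positivity)

/-- The contribution of layer `l` to the wavelet series of `f`. -/
def layer (W : CDVBasis A) (f : I → ℝ) (l : ℕ) (x : I) : ℝ :=
  ∑ k ∈ Finset.range (W.width l), W.coeff f l k * W.fn l k x

theorem continuous_layer (W : CDVBasis A) (f : I → ℝ) (l : ℕ) : Continuous (W.layer f l) :=
  continuous_finsetSum _ fun k _ => continuous_const.mul (W.continuous_fn l k)

/-- The wavelet series of `f`, summed layer by layer. -/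
def series (W : CDVBasis A) (f : I → ℝ) (x : I) : ℝ := ∑' i, W.layer f (W.l₀ + i) x

theorem abs_layer_le (W : CDVBasis A) {M : ℝ}
    (hM : ∀ (l : ℕ) (x : I),
      ∑ k ∈ Finset.range (W.width l), |W.fn l k x| ≤ M * (2 : ℝ) ^ ((l : ℝ) / 2))
    {α ν R : ℝ} {p q : ℝ≥0∞} (hp : 1 ≤ p) (hq : 1 ≤ q) (hν : ν = α - (p⁻¹).toReal) (hR : 0 ≤ R)
    {f : I → ℝ} (hf : f ∈ W.besovBall α p q R) (i : ℕ) (x : I) :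
    |W.layer f (W.l₀ + i) x| ≤ R * M * ((2 : ℝ) ^ (-ν)) ^ (W.l₀ + i) := by
  have hc := fun k hk => W.abs_coeff_le hp hq hν hR hf i (k := k) hk
  generalize W.l₀ + i = l at *
  have h2 : (0 : ℝ) < (2 : ℝ) ^ ((l : ℝ) / 2) := by positivity
  calc |W.layer f l x|
      ≤ ∑ k ∈ Finset.range (W.width l), |W.coeff f l k| * |W.fn l k x| := by
        refine (Finset.abs_sum_le_sum_abs _ _).trans_eq ?_
        simp_rw [abs_mul]
    _ ≤ ∑ k ∈ Finset.range (W.width l),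
          (R * ((2 : ℝ) ^ (-ν)) ^ l / (2 : ℝ) ^ ((l : ℝ) / 2)) * |W.fn l k x| := by
        refine Finset.sum_le_sum fun k hk => ?_
        refine mul_le_mul_of_nonneg_right ?_ (abs_nonneg _)
        exact (le_div_iff₀ h2).2 (hc k (Finset.mem_range.1 hk))
    _ ≤ (R * ((2 : ℝ) ^ (-ν)) ^ l / (2 : ℝ) ^ ((l : ℝ) / 2)) *
          (M * (2 : ℝ) ^ ((l : ℝ) / 2)) := by
        rw [← Finset.mul_sum]
        exact mul_le_mul_of_nonneg_left (hM l x) (by positivity)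
    _ = R * M * ((2 : ℝ) ^ (-ν)) ^ l := by field_simp

theorem two_rpow_neg_lt_one {ν : ℝ} (hν : 0 < ν) : (2 : ℝ) ^ (-ν) < 1 :=
  Real.rpow_lt_one_of_one_lt_of_neg (by norm_num) (by linarith)

theorem hasSum_geometric_shift {r : ℝ} (h0 : 0 ≤ r) (h1 : r < 1) (C : ℝ) (a : ℕ) :
    HasSum (fun i : ℕ => C * r ^ (a + i)) (C * r ^ a * (1 - r)⁻¹) := by
  simp_rw [pow_add, ← mul_assoc]
  exact (hasSum_geometric_of_lt_one h0 h1).mul_left _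

theorem continuous_series (W : CDVBasis A) {M : ℝ}
    (hM : ∀ (l : ℕ) (x : I),
      ∑ k ∈ Finset.range (W.width l), |W.fn l k x| ≤ M * (2 : ℝ) ^ ((l : ℝ) / 2))
    {α ν R : ℝ} {p q : ℝ≥0∞} (hp : 1 ≤ p) (hq : 1 ≤ q) (hν : ν = α - (p⁻¹).toReal) (hν₀ : 0 < ν)
    (hR : 0 ≤ R) {f : I → ℝ} (hf : f ∈ W.besovBall α p q R) : Continuous (W.series f) :=
  continuous_tsum (fun i => W.continuous_layer f _)
    (hasSum_geometric_shift (by positivity) (two_rpow_neg_lt_one hν₀) (R * M) W.l₀).summable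
    fun i x => W.abs_layer_le hM hp hq hν hR hf i x

theorem abs_series_le (W : CDVBasis A) {M : ℝ}
    (hM : ∀ (l : ℕ) (x : I),
      ∑ k ∈ Finset.range (W.width l), |W.fn l k x| ≤ M * (2 : ℝ) ^ ((l : ℝ) / 2))
    {α ν R : ℝ} {p q : ℝ≥0∞} (hp : 1 ≤ p) (hq : 1 ≤ q) (hν : ν = α - (p⁻¹).toReal) (hν₀ : 0 < ν)
    (hR : 0 ≤ R) {f : I → ℝ} (hf : f ∈ W.besovBall α p q R) (x : I) :
    |W.series f x| ≤ R * M * ((2 : ℝ) ^ (-ν)) ^ W.l₀ * (1 - (2 : ℝ) ^ (-ν))⁻¹ := by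
  rw [← Real.norm_eq_abs, series]
  exact tsum_of_norm_bounded
    (hasSum_geometric_shift (by positivity) (two_rpow_neg_lt_one hν₀) (R * M) W.l₀)
    fun i => W.abs_layer_le hM hp hq hν hR hf i x

/-- The wavelet series of a function in the Besov ball converges to it: by orthonormality and
uniform convergence both have the same coefficients. -/
theorem ae_eq_series (W : CDVBasis A) {M : ℝ}
    (hM : ∀ (l : ℕ) (x : I),
      ∑ k ∈ Finset.range (W.width l), |W.fn l k x| ≤ M * (2 : ℝ) ^ ((l : ℝ) / 2))
    {α ν R : ℝ} {p q : ℝ≥0∞} (hp : 1 ≤ p) (hq : 1 ≤ q) (hν : ν = α - (p⁻¹).toReal) (hν₀ : 0 < ν)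
    (hR : 0 ≤ R) {f : I → ℝ} (hf : f ∈ W.besovBall α p q R) : f =ᵐ[volume] W.series f := by
  have hcont := W.continuous_series hM hp hq hν hν₀ hR hf
  have hsL2 : MemLp (W.series f) 2 :=
    MemLp.of_bound hcont.aestronglyMeasurable _
      (Filter.Eventually.of_forall (W.abs_series_le hM hp hq hν hν₀ hR hf))
  refine W.ae_eq_of_coeff_eq hf.1 hsL2 fun l k hl hk => ?_
  obtain ⟨C, hC⟩ := isCompact_univ.exists_bound_of_continuousOn (W.continuous_fn l k).continuousOn
  have hC0 : 0 ≤ C := (norm_nonneg _).trans (hC 0 trivial)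
  have hFint : ∀ i, Integrable fun x => W.layer f (W.l₀ + i) x * W.fn l k x := fun i =>
    integrable_of_continuous ((W.continuous_layer f _).mul (W.continuous_fn l k))
  have hFbound : ∀ i x, ‖W.layer f (W.l₀ + i) x * W.fn l k x‖ ≤
      R * M * C * ((2 : ℝ) ^ (-ν)) ^ (W.l₀ + i) := by
    intro i x
    rw [norm_mul]
    calc _ ≤ R * M * ((2 : ℝ) ^ (-ν)) ^ (W.l₀ + i) * C :=
          mul_le_mul (W.abs_layer_le hM hp hq hν hR hf i x) (hC x trivial) (norm_nonneg _)
            ((abs_nonneg _).trans (W.abs_layer_le hM hp hq hν hR hf i x))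
      _ = _ := by ring
  have hFsum : Summable fun i => ∫ x, ‖W.layer f (W.l₀ + i) x * W.fn l k x‖ := by
    refine Summable.of_nonneg_of_le (fun i => integral_nonneg fun x => norm_nonneg _) (fun i => ?_)
      (hasSum_geometric_shift (by positivity) (two_rpow_neg_lt_one hν₀) (R * M * C)
        W.l₀).summable
    calc _ ≤ ∫ _ : I, R * M * C * ((2 : ℝ) ^ (-ν)) ^ (W.l₀ + i) :=
          integral_mono (hFint i).norm (integrable_const _) (hFbound i)
      _ = _ := by simp
  have h := hasSum_integral_of_summable_integral_norm hFint hFsum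
  have hterm : ∀ i, ∫ x, W.layer f (W.l₀ + i) x * W.fn l k x =
      if W.l₀ + i = l then W.coeff f l k else 0 := by
    intro i
    simp only [layer, Finset.sum_mul, mul_assoc]
    rw [integral_finsetSum]
    swap
    · exact fun k' _ => integrable_of_continuous (continuous_const.mul
        ((W.continuous_fn _ k').mul (W.continuous_fn l k)))
    simp_rw [integral_const_mul]
    split_ifs with hi
    · subst hi
      rw [Finset.sum_eq_single_of_mem k (Finset.mem_range.2 hk)]
      · rw [W.integral_fn_mul_fn hl hk hl hk]; simp
      · intro k' hk' hne
        rw [W.integral_fn_mul_fn hl (Finset.mem_range.1 hk') hl hk]; simp [hne]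
    · refine Finset.sum_eq_zero fun k' hk' => ?_
      rw [W.integral_fn_mul_fn (by omega) (Finset.mem_range.1 hk') hl hk]; simp [hi]
  have hser : ∫ x, (∑' i, W.layer f (W.l₀ + i) x * W.fn l k x) = W.coeff (W.series f) l k := by
    simp_rw [tsum_mul_right, coeff, series]
  rw [hser, funext hterm] at h
  refine (h.unique ?_).symm
  have hiff : ∀ i, W.l₀ + i = l ↔ i = l - W.l₀ := fun i => by omega
  simp_rw [hiff]
  exact hasSum_ite_eq (l - W.l₀) (W.coeff f l k)

theorem abs_sum_layer_sub_series_le (W : CDVBasis A) {M : ℝ}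
    (hM : ∀ (l : ℕ) (x : I),
      ∑ k ∈ Finset.range (W.width l), |W.fn l k x| ≤ M * (2 : ℝ) ^ ((l : ℝ) / 2))
    {α ν R : ℝ} {p q : ℝ≥0∞} (hp : 1 ≤ p) (hq : 1 ≤ q) (hν : ν = α - (p⁻¹).toReal) (hν₀ : 0 < ν)
    (hR : 0 ≤ R) {f : I → ℝ} (hf : f ∈ W.besovBall α p q R)
    {L : ℕ} (hL : W.l₀ ≤ L) (x : I) :
    |∑ l ∈ Finset.Icc W.l₀ L, W.layer f l x - W.series f x| ≤
      R * M * (1 - (2 : ℝ) ^ (-ν))⁻¹ * ((2 : ℝ) ^ (-ν)) ^ L := by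
  have h0 : (0 : ℝ) ≤ (2 : ℝ) ^ (-ν) := by positivity
  have h1 := two_rpow_neg_lt_one hν₀
  have hlb := W.abs_layer_le hM hp hq hν hR hf (x := x)
  have hRM : 0 ≤ R * M := by
    have := (abs_nonneg _).trans (hlb 0)
    exact nonneg_of_mul_nonneg_left this (by positivity)
  have hs : Summable fun i => W.layer f (W.l₀ + i) x :=
    Summable.of_norm_bounded (hasSum_geometric_shift h0 h1 (R * M) W.l₀).summable hlb
  have hsplit := hs.sum_add_tsum_nat_add (L + 1 - W.l₀)
  have hIcc : ∑ l ∈ Finset.Icc W.l₀ L, W.layer f l x =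
      ∑ i ∈ Finset.range (L + 1 - W.l₀), W.layer f (W.l₀ + i) x := by
    rw [← Finset.sum_Ico_eq_sum_range (fun l => W.layer f l x)]; rfl
  rw [hIcc, series, ← hsplit, sub_add_cancel_left, abs_neg]
  have ht : |∑' i, W.layer f (W.l₀ + (i + (L + 1 - W.l₀))) x| ≤
      R * M * ((2 : ℝ) ^ (-ν)) ^ (L + 1) * (1 - (2 : ℝ) ^ (-ν))⁻¹ := by
    rw [← Real.norm_eq_abs]
    refine tsum_of_norm_bounded (hasSum_geometric_shift h0 h1 (R * M) (L + 1)) fun i => ?_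
    rw [Real.norm_eq_abs]
    have := hlb (i + (L + 1 - W.l₀))
    rwa [show W.l₀ + (i + (L + 1 - W.l₀)) = L + 1 + i by omega] at this ⊢
  refine ht.trans ?_
  rw [mul_right_comm, pow_succ]
  refine mul_le_mul_of_nonneg_left ?_ (mul_nonneg hRM (inv_nonneg.2 (by linarith)))
  exact mul_le_of_le_one_right (by positivity) h1.le

end CDVBasis

/-! ### Continuous functions on the unit interval -/

/-- Lebesgue measure on `[0,1]` charges every non-empty relatively open set. -/
theorem isOpenPosMeasure_unitInterval : (volume : Measure I).IsOpenPosMeasure := by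
  refine ⟨fun U hU hne => ?_⟩
  obtain ⟨V, hV, rfl⟩ := isOpen_induced_iff.1 hU
  obtain ⟨x, hx⟩ := hne
  have hcl : (x : ℝ) ∈ closure (Set.Ioo (0 : ℝ) 1) := by
    rw [closure_Ioo (by norm_num)]; exact x.2
  have hne' : (V ∩ Set.Ioo (0 : ℝ) 1).Nonempty := mem_closure_iff.1 hcl V hV hx
  have hpos := (hV.inter isOpen_Ioo).measure_pos (volume : Measure ℝ) hne'
  rw [unitInterval.volume_apply, Subtype.image_preimage_coe]
  refine (hpos.trans_le (measure_mono ?_)).ne'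
  exact fun y hy => ⟨Set.Ioo_subset_Icc_self hy.2, hy.1⟩

theorem eq_of_ae_eq_of_continuous {f g : I → ℝ} (hf : Continuous f) (hg : Continuous g)
    (h : f =ᵐ[volume] g) : f = g := by
  have := isOpenPosMeasure_unitInterval
  exact (Continuous.ae_eq_iff_eq volume hf hg).1 h

theorem abs_le_of_ae_abs_le {f : I → ℝ} (hf : Continuous f) {B : ℝ} (h : ∀ᵐ x, |f x| ≤ B) (x : I) :
    |f x| ≤ B := by
  have := isOpenPosMeasure_unitInterval
  have hd : Dense {x : I | |f x| ≤ B} := Measure.dense_of_ae h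
  have hc : IsClosed {x : I | |f x| ≤ B} := isClosed_le hf.abs continuous_const
  have hx := hd x
  rwa [hc.closure_eq] at hx

/-! ### The regression model -/

theorem measurable_regressionMap {f : I → ℝ} (hf : Measurable f) :
    Measurable fun w : I × ℝ => ((f w.1 + w.2, w.1) : Obs) := by fun_prop

theorem isProbabilityMeasure_regressionLaw {f : I → ℝ} (hf : Measurable f) :
    IsProbabilityMeasure (regressionLaw f) :=
  Measure.isProbabilityMeasure_map (measurable_regressionMap hf).aemeasurable

theorem integral_regressionLaw {f : I → ℝ} (hf : Measurable f) {g : Obs → ℝ} (hg : Measurable g)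
    {C : ℝ} (hC : ∀ z, |g z| ≤ C) :
    ∫ z, g z ∂(regressionLaw f) = ∫ x : I, ∫ w, g (f x + w, x) ∂(gaussianReal 0 1) := by
  rw [regressionLaw, integral_map (measurable_regressionMap hf).aemeasurable
    hg.aestronglyMeasurable, integral_prod]
  exact Integrable.of_bound (hg.comp (measurable_regressionMap hf)).aestronglyMeasurable C
    (Filter.Eventually.of_forall fun w => hC _)

namespace CDVBasis

variable {A : ℕ}

/-- The summand of the local estimator that belongs to one observation. -/
def summand (W : CDVBasis A) (L : ℕ) (τ : ℝ) (x₀ : I) (z : Obs) : ℝ :=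
  clip τ z.1 * W.kernel L x₀ z.2

theorem measurable_summand (W : CDVBasis A) (L : ℕ) (τ : ℝ) (x₀ : I) :
    Measurable (W.summand L τ x₀) :=
  ((measurable_clip τ).comp measurable_fst).mul
    ((W.continuous_kernel L x₀).measurable.comp measurable_snd)

theorem abs_summand_le (W : CDVBasis A) {M : ℝ}
    (hM : ∀ (l : ℕ) (x : I),
      ∑ k ∈ Finset.range (W.width l), |W.fn l k x| ≤ M * (2 : ℝ) ^ ((l : ℝ) / 2))
    (L : ℕ) {τ : ℝ} (hτ : 0 ≤ τ) (x₀ : I) (z : Obs) :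
    |W.summand L τ x₀ z| ≤ τ * (2 * M ^ 2 * 2 ^ L) := by
  rw [summand, abs_mul]
  exact mul_le_mul (abs_clip_le hτ _) (W.abs_kernel_le hM L x₀ _) (abs_nonneg _) hτ

theorem memLp_summand (W : CDVBasis A) {M : ℝ}
    (hM : ∀ (l : ℕ) (x : I),
      ∑ k ∈ Finset.range (W.width l), |W.fn l k x| ≤ M * (2 : ℝ) ^ ((l : ℝ) / 2))
    (L : ℕ) {τ : ℝ} (hτ : 0 ≤ τ) (x₀ : I) {f : I → ℝ} (hf : Measurable f) :
    MemLp (W.summand L τ x₀) 2 (regressionLaw f) := by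
  have := isProbabilityMeasure_regressionLaw hf
  exact MemLp.of_bound (W.measurable_summand L τ x₀).aestronglyMeasurable _
    (Filter.Eventually.of_forall (W.abs_summand_le hM L hτ x₀))

/-- The bias caused by clipping at height `t` above the bound `B` on the regression function. -/
theorem abs_integral_summand_sub_le (W : CDVBasis A) {M : ℝ}
    (hM : ∀ (l : ℕ) (x : I),
      ∑ k ∈ Finset.range (W.width l), |W.fn l k x| ≤ M * (2 : ℝ) ^ ((l : ℝ) / 2))
    (L : ℕ) {B t : ℝ} (ht : 1 ≤ t) (x₀ : I) {f : I → ℝ} (hf : Continuous f)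
    (hB : ∀ x, |f x| ≤ B) :
    |(∫ z, W.summand L (B + t) x₀ z ∂(regressionLaw f)) - ∫ x, f x * W.kernel L x₀ x| ≤
      2 * Real.exp (-(t ^ 2 / 2)) * (2 * M ^ 2 * 2 ^ L) := by
  have hB0 : 0 ≤ B := (abs_nonneg _).trans (hB 0)
  have hτ : 0 ≤ B + t := by linarith
  rw [integral_regressionLaw hf.measurable (W.measurable_summand L _ x₀)
    (W.abs_summand_le hM L hτ x₀)]
  simp only [summand, integral_mul_const]
  have hmeas : StronglyMeasurable fun x : I =>
      ∫ w, clip (B + t) (f x + w) ∂(gaussianReal 0 1) := by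
    refine StronglyMeasurable.integral_prod_right
      (f := fun (x : I) (w : ℝ) => clip (B + t) (f x + w)) ?_
    exact ((measurable_clip _).comp
      ((hf.measurable.comp measurable_fst).add measurable_snd)).stronglyMeasurable
  have hk := (W.continuous_kernel L x₀).measurable
  have hpt : ∀ x, ‖(∫ w, clip (B + t) (f x + w) ∂(gaussianReal 0 1)) * W.kernel L x₀ x -
      f x * W.kernel L x₀ x‖ ≤ 2 * Real.exp (-(t ^ 2 / 2)) * (2 * M ^ 2 * 2 ^ L) := by
    intro x
    rw [← sub_mul, norm_mul]
    exact mul_le_mul (abs_integral_clip_add_sub_le ht (hB x)) (W.abs_kernel_le hM L x₀ x)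
      (abs_nonneg _) (by positivity)
  have hint2 : Integrable fun x => f x * W.kernel L x₀ x := integrable_of_continuous (hf.mul (W.continuous_kernel L x₀))
  have hint1 : Integrable fun x =>
      (∫ w, clip (B + t) (f x + w) ∂(gaussianReal 0 1)) * W.kernel L x₀ x := by
    refine Integrable.of_bound (hmeas.measurable.mul hk).aestronglyMeasurable
      ((B + t) * (2 * M ^ 2 * 2 ^ L)) (Filter.Eventually.of_forall fun x => ?_)
    rw [norm_mul]
    refine mul_le_mul ?_ (W.abs_kernel_le hM L x₀ x) (norm_nonneg _) hτ
    refine (norm_integral_le_of_norm_le_const (C := B + t)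
      (Filter.Eventually.of_forall fun w => abs_clip_le hτ _)).trans ?_
    simp
  rw [← integral_sub hint1 hint2]
  refine (norm_integral_le_of_norm_le_const (μ := (volume : Measure I))
    (Filter.Eventually.of_forall hpt)).trans ?_
  simp

/-- Orthonormality turns the second moment of the kernel into its value on the diagonal, of order
`2 ^ L` rather than the order `4 ^ L` of the squared supremum. -/
theorem variance_summand_le (W : CDVBasis A) {M : ℝ}
    (hM : ∀ (l : ℕ) (x : I),
      ∑ k ∈ Finset.range (W.width l), |W.fn l k x| ≤ M * (2 : ℝ) ^ ((l : ℝ) / 2))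
    (L : ℕ) {τ : ℝ} (hτ : 0 ≤ τ) (x₀ : I) {f : I → ℝ} (hf : Measurable f) :
    Var[W.summand L τ x₀; regressionLaw f] ≤ τ ^ 2 * (2 * M ^ 2 * 2 ^ L) := by
  have := isProbabilityMeasure_regressionLaw hf
  have hk := (W.continuous_kernel L x₀).measurable
  have hmeas : Measurable fun z : Obs => τ ^ 2 * W.kernel L x₀ z.2 ^ 2 := by fun_prop
  have hbd : ∀ z : Obs, |τ ^ 2 * W.kernel L x₀ z.2 ^ 2| ≤ τ ^ 2 * (2 * M ^ 2 * 2 ^ L) ^ 2 := by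
    intro z
    rw [abs_of_nonneg (by positivity), ← sq_abs (W.kernel L x₀ z.2)]
    gcongr
    exact W.abs_kernel_le hM L x₀ z.2
  calc Var[W.summand L τ x₀; regressionLaw f]
      ≤ ∫ z, W.summand L τ x₀ z ^ 2 ∂(regressionLaw f) :=
        variance_le_expectation_sq (W.measurable_summand L τ x₀).aestronglyMeasurable
    _ ≤ ∫ z, τ ^ 2 * W.kernel L x₀ z.2 ^ 2 ∂(regressionLaw f) := by
        refine integral_mono (W.memLp_summand hM L hτ x₀ hf).integrable_sq
          (Integrable.of_bound hmeas.aestronglyMeasurable _ (Filter.Eventually.of_forall hbd))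
          fun z => ?_
        simp only [summand, mul_pow]
        refine mul_le_mul_of_nonneg_right ?_ (sq_nonneg _)
        exact sq_le_sq' (abs_le.1 (abs_clip_le hτ _)).1 (abs_le.1 (abs_clip_le hτ _)).2
    _ = τ ^ 2 * W.kernel L x₀ x₀ := by
        rw [integral_regressionLaw hf hmeas hbd]
        simp [integral_const_mul, W.integral_kernel_sq]
    _ ≤ _ := mul_le_mul_of_nonneg_left ((le_abs_self _).trans (W.abs_kernel_le hM L x₀ x₀))
        (sq_nonneg τ)

/-! ### Privacy of the transcripts -/

/-- The sensitivity of the local estimator. -/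
theorem abs_localEst_sub_le (W : CDVBasis A) {M : ℝ}
    (hM : ∀ (l : ℕ) (x : I),
      ∑ k ∈ Finset.range (W.width l), |W.fn l k x| ≤ M * (2 : ℝ) ^ ((l : ℝ) / 2))
    (L : ℕ) {τ : ℝ} (hτ : 0 ≤ τ) (x₀ : I) [DecidableEq Obs] {n : ℕ} {z z' : Fin n → Obs}
    (h : hammingDist z z' ≤ 1) :
    |W.localEst L τ x₀ z - W.localEst L τ x₀ z'| ≤ 4 * M ^ 2 * τ * 2 ^ L / n := by
  set G := τ * (2 * M ^ 2 * 2 ^ L) with hG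
  have hG0 : 0 ≤ G := by positivity
  have hsum : |∑ i, (W.summand L τ x₀ (z i) - W.summand L τ x₀ (z' i))| ≤ 2 * G := by
    calc _ ≤ ∑ i, |W.summand L τ x₀ (z i) - W.summand L τ x₀ (z' i)| :=
          Finset.abs_sum_le_sum_abs _ _
      _ ≤ ∑ i, if z i ≠ z' i then 2 * G else 0 := by
          refine Finset.sum_le_sum fun i _ => ?_
          split_ifs with hi
          · refine (abs_sub _ _).trans ?_
            linarith [W.abs_summand_le hM L hτ x₀ (z i), W.abs_summand_le hM L hτ x₀ (z' i)]
          · rw [not_not.1 hi, sub_self, abs_zero]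
      _ = hammingDist z z' * (2 * G) := by
          rw [← Finset.sum_filter, Finset.sum_const, nsmul_eq_mul]; rfl
      _ ≤ 2 * G := mul_le_of_le_one_left (by positivity) (by exact_mod_cast h)
  rw [localEst_eq, localEst_eq, ← mul_sub, ← Finset.sum_sub_distrib, abs_mul,
    abs_of_nonneg (by positivity)]
  calc _ ≤ 1 / (n : ℝ) * (2 * G) := mul_le_mul_of_nonneg_left hsum (by positivity)
    _ = _ := by rw [hG]; ring

theorem noiseScale_pos {c τ : ℝ} (hc : 0 < c) (hτ : 0 < τ) (L : ℕ) {n : ℕ} (hn : 1 ≤ n) {ε : ℝ}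
    (hε : 0 < ε) : 0 < noiseScale c τ L n ε := by
  have : (0 : ℝ) < n := by exact_mod_cast hn
  unfold noiseScale
  positivity

theorem isDP_transcriptLaw (W : CDVBasis A) {M : ℝ}
    (hM : ∀ (l : ℕ) (x : I),
      ∑ k ∈ Finset.range (W.width l), |W.fn l k x| ≤ M * (2 : ℝ) ^ ((l : ℝ) / 2))
    {c τ : ℝ} (hc : 0 < c) (hcM : 4 * M ^ 2 ≤ c) (hτ : 0 < τ) (L : ℕ) (x₀ : I) [DecidableEq Obs]
    {n : ℕ} (hn : 1 ≤ n) {ε : ℝ} (hε : 0 < ε) (δ : ℝ) :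
    IsDP (fun z : Fin n → Obs => W.transcriptLaw c L τ x₀ ε z) ε δ := by
  intro z z' h S hS
  refine le_add_right (map_const_add_laplace_le (noiseScale_pos hc hτ L hn hε) ?_ hS)
  refine (W.abs_localEst_sub_le hM L hτ.le x₀ h).trans ?_
  have hn' : (0 : ℝ) < n := by exact_mod_cast hn
  rw [noiseScale, show ε * (c * τ * 2 ^ L / (n * ε)) = c * τ * 2 ^ L / n by field_simp]
  gcongr

/-! ### Mean and variance of the transcripts -/

theorem localEst_eq_sum (W : CDVBasis A) (L : ℕ) (τ : ℝ) (x₀ : I) {n : ℕ} :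
    W.localEst (n := n) L τ x₀ =
      fun z => ∑ i, 1 / (n : ℝ) * W.summand L τ x₀ (z i) := by
  ext z
  rw [localEst_eq, Finset.mul_sum]
  rfl

/-- The transcript of a server as a function of its data and of the noise. -/
def transcript (W : CDVBasis A) (L : ℕ) (τ : ℝ) (x₀ : I) {n : ℕ} (w : (Fin n → Obs) × ℝ) : ℝ :=
  W.localEst L τ x₀ w.1 + w.2

theorem memLp_localEst (W : CDVBasis A) {M : ℝ}
    (hM : ∀ (l : ℕ) (x : I),
      ∑ k ∈ Finset.range (W.width l), |W.fn l k x| ≤ M * (2 : ℝ) ^ ((l : ℝ) / 2))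
    (L : ℕ) {τ : ℝ} (hτ : 0 ≤ τ) (x₀ : I) {f : I → ℝ} (hf : Measurable f) {n : ℕ} :
    MemLp (W.localEst (n := n) L τ x₀) 2 (Measure.pi fun _ : Fin n => regressionLaw f) := by
  have := isProbabilityMeasure_regressionLaw hf
  rw [localEst_eq_sum]
  exact memLp_finsetSum _ fun i _ => ((W.memLp_summand hM L hτ x₀ hf).const_mul
    _).comp_measurePreserving (measurePreserving_eval (fun _ : Fin n => regressionLaw f) i)

theorem integral_localEst (W : CDVBasis A) {M : ℝ}
    (hM : ∀ (l : ℕ) (x : I),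
      ∑ k ∈ Finset.range (W.width l), |W.fn l k x| ≤ M * (2 : ℝ) ^ ((l : ℝ) / 2))
    (L : ℕ) {τ : ℝ} (hτ : 0 ≤ τ) (x₀ : I) {f : I → ℝ} (hf : Measurable f) {n : ℕ} (hn : 1 ≤ n) :
    ∫ z, W.localEst (n := n) L τ x₀ z ∂(Measure.pi fun _ : Fin n => regressionLaw f) =
      ∫ z, W.summand L τ x₀ z ∂(regressionLaw f) := by
  have := isProbabilityMeasure_regressionLaw hf
  have hn' : (n : ℝ) ≠ 0 := by positivity
  have hm := W.memLp_summand hM L hτ x₀ hf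
  rw [localEst_eq_sum, integral_finsetSum]
  swap
  · exact fun i _ => ((hm.comp_measurePreserving
      (measurePreserving_eval (fun _ : Fin n => regressionLaw f) i)).integrable
        one_le_two).const_mul _
  simp_rw [integral_const_mul]
  rw [Finset.sum_congr rfl fun i _ => by
    rw [integral_comp_eval (μ := fun _ : Fin n => regressionLaw f) (i := i)
      hm.aestronglyMeasurable]]
  simp
  field_simp

theorem variance_localEst_le (W : CDVBasis A) {M : ℝ}
    (hM : ∀ (l : ℕ) (x : I),
      ∑ k ∈ Finset.range (W.width l), |W.fn l k x| ≤ M * (2 : ℝ) ^ ((l : ℝ) / 2))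
    (L : ℕ) {τ : ℝ} (hτ : 0 ≤ τ) (x₀ : I) {f : I → ℝ} (hf : Measurable f) {n : ℕ} (hn : 1 ≤ n) :
    Var[W.localEst (n := n) L τ x₀; Measure.pi fun _ : Fin n => regressionLaw f] ≤
      τ ^ 2 * (2 * M ^ 2 * 2 ^ L) / n := by
  have := isProbabilityMeasure_regressionLaw hf
  have hn' : (0 : ℝ) < n := by exact_mod_cast hn
  have hm := W.memLp_summand hM L hτ x₀ hf
  have hv := variance_sum_pi (μ := fun _ : Fin n => regressionLaw f)
    (X := fun _ z => 1 / (n : ℝ) * W.summand L τ x₀ z) fun _ => hm.const_mul _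
  have heq : (∑ i : Fin n, fun z : Fin n → Obs => 1 / (n : ℝ) * W.summand L τ x₀ (z i)) =
      W.localEst L τ x₀ := by
    rw [localEst_eq_sum]; ext z; simp
  rw [heq] at hv
  rw [hv]
  simp_rw [variance_const_mul]
  rw [Finset.sum_const, Finset.card_univ, Fintype.card_fin, nsmul_eq_mul]
  calc (n : ℝ) * ((1 / (n : ℝ)) ^ 2 * Var[W.summand L τ x₀; regressionLaw f])
      = Var[W.summand L τ x₀; regressionLaw f] / n := by field_simp
    _ ≤ _ := by gcongr; exact W.variance_summand_le hM L hτ x₀ hf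

end CDVBasis

/-- Bias-variance decomposition for an affine combination of independent estimators with a common
mean. -/
theorem lintegral_sq_sum_sub_eq {m : ℕ} {Ω : Fin m → Type*} [∀ j, MeasurableSpace (Ω j)]
    {μ : ∀ j, Measure (Ω j)} [∀ j, IsProbabilityMeasure (μ j)] {X : ∀ j, Ω j → ℝ}
    (hX : ∀ j, MemLp (X j) 2 (μ j)) {a : ℝ} (ha : ∀ j, ∫ w, X j w ∂(μ j) = a)
    {u : Fin m → ℝ} (hu : ∑ j, u j = 1) (y : ℝ) :
    ∫⁻ ω, ENNReal.ofReal ((∑ j, u j * X j (ω j) - y) ^ 2) ∂(Measure.pi μ) =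
      ENNReal.ofReal ((a - y) ^ 2 + ∑ j, u j ^ 2 * Var[X j; μ j]) := by
  have hcomp : ∀ j, MemLp (fun ω : ∀ j, Ω j => u j * X j (ω j)) 2 (Measure.pi μ) := fun j =>
    ((hX j).const_mul (u j)).comp_measurePreserving (measurePreserving_eval μ j)
  have hS : MemLp (fun ω : ∀ j, Ω j => ∑ j, u j * X j (ω j)) 2 (Measure.pi μ) :=
    memLp_finsetSum _ fun j _ => hcomp j
  have hSy : MemLp (fun ω : ∀ j, Ω j => ∑ j, u j * X j (ω j) - y) 2 (Measure.pi μ) :=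
    hS.sub (memLp_const y)
  have hmean : ∫ ω, (∑ j, u j * X j (ω j)) ∂(Measure.pi μ) = a := by
    rw [integral_finsetSum _ fun j _ => (hcomp j).integrable one_le_two]
    simp_rw [integral_const_mul]
    rw [Finset.sum_congr rfl fun j _ => by
      rw [integral_comp_eval (hX j).aestronglyMeasurable, ha j], ← Finset.sum_mul, hu, one_mul]
  have hvar : Var[fun ω : ∀ j, Ω j => ∑ j, u j * X j (ω j); Measure.pi μ] =
      ∑ j, u j ^ 2 * Var[X j; μ j] := by
    have h := variance_sum_pi (μ := μ) (X := fun j w => u j * X j w) fun j => (hX j).const_mul _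
    simp_rw [variance_const_mul] at h
    rw [← h]
    congr 1
    ext ω
    simp
  have hdec := variance_eq_sub hSy
  rw [variance_sub_const hS.aestronglyMeasurable, hvar, integral_sub (hS.integrable one_le_two)
    (integrable_const y), hmean] at hdec
  rw [← ofReal_integral_eq_lintegral_ofReal hSy.integrable_sq
    (Filter.Eventually.of_forall fun _ => sq_nonneg _)]
  congr 1
  simp only [integral_const, probReal_univ, one_smul, Pi.pow_apply] at hdec
  linarith

namespace CDVBasis

variable {A : ℕ}

/-- The mean squared error is at most the squared bias of one summand plus the weighted variance
bounds of the transcripts. -/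
theorem mse_le (W : CDVBasis A) {M : ℝ}
    (hM : ∀ (l : ℕ) (x : I),
      ∑ k ∈ Finset.range (W.width l), |W.fn l k x| ≤ M * (2 : ℝ) ^ ((l : ℝ) / 2))
    {c τ : ℝ} (hc : 0 < c) (hτ : 0 < τ) (L : ℕ) (x₀ : I) {m : ℕ} {n : Fin m → ℕ}
    (hn : ∀ j, 1 ≤ n j) {ε : Fin m → ℝ} (hε : ∀ j, 0 < ε j) (hu : ∑ j, weight L n ε j = 1)
    {f : I → ℝ} (hf : Measurable f) :
    W.mse c L τ x₀ n ε f ≤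
      ENNReal.ofReal (((∫ z, W.summand L τ x₀ z ∂(regressionLaw f)) - f x₀) ^ 2 +
        ∑ j, weight L n ε j ^ 2 *
          (τ ^ 2 * (2 * M ^ 2 * 2 ^ L) / n j + 2 * noiseScale c τ L (n j) (ε j) ^ 2)) := by
  have := isProbabilityMeasure_regressionLaw hf
  have hb := fun j => noiseScale_pos hc hτ L (hn j) (hε j)
  have := fun j => isProbabilityMeasure_laplace (hb j)
  have hloc := fun j => W.memLp_localEst hM L hτ.le x₀ hf (n := n j)
  have hlap := fun j => memLp_id_laplace (hb j)
  have hX : ∀ j, MemLp (W.transcript (n := n j) L τ x₀) 2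
      ((Measure.pi fun _ : Fin (n j) => regressionLaw f).prod
        (laplace (noiseScale c τ L (n j) (ε j)))) := fun j =>
    ((hloc j).comp_fst _).add ((hlap j).comp_snd _)
  have hmean : ∀ j, ∫ w, W.transcript (n := n j) L τ x₀ w
      ∂((Measure.pi fun _ : Fin (n j) => regressionLaw f).prod
        (laplace (noiseScale c τ L (n j) (ε j)))) =
      ∫ z, W.summand L τ x₀ z ∂(regressionLaw f) := by
    intro j
    simp only [transcript]
    rw [integral_add (((hloc j).comp_fst _).integrable one_le_two)
      (((hlap j).comp_snd _).integrable one_le_two), integral_fun_fst, integral_fun_snd (fun x => x),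
      integral_id_laplace (hb j), W.integral_localEst hM L hτ.le x₀ hf (hn j)]
    simp
  have h := lintegral_sq_sum_sub_eq hX hmean hu (f x₀)
  refine (le_of_eq h).trans (ENNReal.ofReal_le_ofReal ?_)
  gcongr with j
  have hv := variance_add_prod (hloc j) (hlap j)
  rw [variance_id_laplace (hb j)] at hv
  refine hv.trans_le ?_
  gcongr
  exact W.variance_localEst_le hM L hτ.le x₀ hf (hn j)

/-! ### Weights and resolution level -/

theorem rawWeight_pos (L : ℕ) {n : ℕ} (hn : 1 ≤ n) {ε : ℝ} (hε : 0 < ε) : 0 < rawWeight L n ε := by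
  have : (0 : ℝ) < n := by exact_mod_cast hn
  unfold rawWeight
  positivity

/-- The variance of a transcript is, up to constants, `τ ^ 2 * 4 ^ L` over its raw weight. -/
theorem variance_bound_le {M c τ : ℝ} (L : ℕ) {n : ℕ} (hn : 1 ≤ n) {ε : ℝ} (hε : 0 < ε) :
    τ ^ 2 * (2 * M ^ 2 * 2 ^ L) / n + 2 * noiseScale c τ L n ε ^ 2 ≤
      (2 * M ^ 2 + 2 * c ^ 2) * τ ^ 2 * (2 ^ L) ^ 2 / rawWeight L n ε := by
  have hn' : (0 : ℝ) < n := by exact_mod_cast hn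
  have hv := rawWeight_pos L hn hε
  have h1 : τ ^ 2 * (2 * M ^ 2 * 2 ^ L) / n ≤ 2 * M ^ 2 * τ ^ 2 * (2 ^ L) ^ 2 / rawWeight L n ε := by
    calc _ = 2 * M ^ 2 * τ ^ 2 * (2 ^ L) ^ 2 / (n * 2 ^ L) := by field_simp
      _ ≤ _ := by gcongr; exact min_le_right _ _
  have h2 : 2 * noiseScale c τ L n ε ^ 2 ≤ 2 * c ^ 2 * τ ^ 2 * (2 ^ L) ^ 2 / rawWeight L n ε := by
    calc _ = 2 * c ^ 2 * τ ^ 2 * (2 ^ L) ^ 2 / ((n : ℝ) ^ 2 * ε ^ 2) := by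
          unfold noiseScale; field_simp
      _ ≤ _ := by gcongr; exact min_le_left _ _
  refine (add_le_add h1 h2).trans_eq ?_
  ring

/-- Since the weights are proportional to the inverse of the variance bounds, the weighted sum of
these bounds collapses to the common numerator over the total raw weight. -/
theorem sum_weight_sq_mul_le {M c τ : ℝ} (L : ℕ) {m : ℕ} {n : Fin m → ℕ} (hn : ∀ j, 1 ≤ n j)
    {ε : Fin m → ℝ} (hε : ∀ j, 0 < ε j) :
    ∑ j, weight L n ε j ^ 2 *
        (τ ^ 2 * (2 * M ^ 2 * 2 ^ L) / n j + 2 * noiseScale c τ L (n j) (ε j) ^ 2) ≤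
      (2 * M ^ 2 + 2 * c ^ 2) * τ ^ 2 * (2 ^ L) ^ 2 / ∑ j, rawWeight L (n j) (ε j) := by
  set K := (2 * M ^ 2 + 2 * c ^ 2) * τ ^ 2 * (2 ^ L) ^ 2 with hK
  set V := ∑ j, rawWeight L (n j) (ε j) with hV
  calc _ ≤ ∑ j, K / V ^ 2 * rawWeight L (n j) (ε j) := by
        refine Finset.sum_le_sum fun j _ => ?_
        have hv := rawWeight_pos L (hn j) (hε j)
        refine (mul_le_mul_of_nonneg_left (variance_bound_le L (hn j) (hε j))
          (sq_nonneg _)).trans_eq ?_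
        rw [weight, ← hK, ← hV]
        field_simp
    _ = K / V := by
        rw [← Finset.mul_sum, ← hV]
        rcases eq_or_ne V 0 with h | h
        · simp [h]
        · field_simp

theorem le_two_pow_resolution (W : CDVBasis A) {D : ℝ} (hD : 0 < D) :
    D ≤ 2 ^ W.resolution D := by
  rw [← Real.rpow_natCast]
  nth_rw 1 [← Real.rpow_logb (b := 2) (by norm_num) (by norm_num) hD]
  refine Real.rpow_le_rpow_of_exponent_le (by norm_num) ((Nat.le_ceil _).trans ?_)
  exact_mod_cast le_max_right _ _

theorem one_le_resolution (W : CDVBasis A) (D : ℝ) : 1 ≤ W.resolution D :=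
  le_max_of_le_left (by omega)

theorem le_resolution (W : CDVBasis A) (D : ℝ) : W.l₀ ≤ W.resolution D :=
  le_max_of_le_left (by omega)

/-- If `L` is not capped below by `l₀ + 1`, then `2 ^ L ≤ 2 D`; otherwise `2 ^ L` is a constant and
`D ≥ d₀` is what keeps `D` comparable with it. -/
theorem two_pow_resolution_le (W : CDVBasis A) {d₀ D : ℝ} (hd : 0 < d₀) (hD : d₀ ≤ D) :
    min (d₀ / 2 ^ (W.l₀ + 1)) (1 / 2) * 2 ^ W.resolution D ≤ D := by
  have hD₀ : 0 < D := hd.trans_le hD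
  rcases le_or_gt ⌈Real.logb 2 D⌉₊ (W.l₀ + 1) with h | h
  · rw [resolution, max_eq_left h]
    calc _ ≤ d₀ / 2 ^ (W.l₀ + 1) * 2 ^ (W.l₀ + 1) := by gcongr; exact min_le_left _ _
      _ = d₀ := by field_simp
      _ ≤ D := hD
  · rw [resolution, max_eq_right h.le]
    have hlog : 0 ≤ Real.logb 2 D := by
      by_contra hneg
      rw [Nat.ceil_eq_zero.2 (not_le.1 hneg).le] at h
      omega
    have h2 : (2 : ℝ) ^ ⌈Real.logb 2 D⌉₊ ≤ 2 * D := by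
      rw [← Real.rpow_natCast]
      calc _ ≤ (2 : ℝ) ^ (Real.logb 2 D + 1) :=
            Real.rpow_le_rpow_of_exponent_le (by norm_num) (Nat.ceil_lt_add_one hlog).le
        _ = 2 * D := by
            rw [Real.rpow_add (by norm_num), Real.rpow_logb (by norm_num) (by norm_num) hD₀,
              Real.rpow_one, mul_comm]
    calc _ ≤ 1 / 2 * (2 * D) :=
          mul_le_mul (min_le_right _ _) h2 (by positivity) (by norm_num)
      _ = D := by ring

theorem resolution_le_mul_log (W : CDVBasis A) {N D : ℝ} (hN : 2 ≤ N) (hD : 0 < D) (hDN : D ≤ N) :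
    (W.resolution D : ℝ) ≤ (W.l₀ + 3) / Real.log 2 * Real.log N := by
  have hlog : Real.logb 2 D ≤ Real.logb 2 N := Real.logb_le_logb_of_le (by norm_num) hD hDN
  have hN1 : 1 ≤ Real.logb 2 N := by
    rw [Real.le_logb_iff_rpow_le (by norm_num) (by linarith), Real.rpow_one]; exact hN
  have hceil : (⌈Real.logb 2 D⌉₊ : ℝ) ≤ Real.logb 2 N + 1 :=
    (Nat.cast_le.2 (Nat.ceil_mono hlog)).trans (Nat.ceil_lt_add_one (by linarith)).le
  rw [div_mul_eq_mul_div, mul_div_assoc, ← Real.logb]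
  have hl : (0 : ℝ) ≤ W.l₀ := Nat.cast_nonneg _
  rw [resolution, Nat.cast_max]
  push_cast
  refine max_le ?_ (hceil.trans ?_) <;> nlinarith

/-- The equation for `D` gives `D ^ (2 * ν + 2) ≤ N * D`, so `D ≤ N` as soon as `D > 1`. -/
theorem le_sum_of_rpow_eq {ν D : ℝ} (hν : 0 < ν) (hD : 0 < D) {m : ℕ} {n : Fin m → ℕ}
    {ε : Fin m → ℝ}
    (h : D ^ (2 * ν + 2) = ∑ j, min ((n j : ℝ) ^ 2 * ε j ^ 2) (n j * D))
    (hN : 2 ≤ ∑ j, n j) : D ≤ ((∑ j, n j : ℕ) : ℝ) := by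
  have hN' : (2 : ℝ) ≤ ((∑ j, n j : ℕ) : ℝ) := by exact_mod_cast hN
  rcases le_or_gt D 1 with h1 | h1
  · linarith
  have h2 : D ^ (2 * ν + 2) ≤ ((∑ j, n j : ℕ) : ℝ) * D := by
    rw [h]
    push_cast
    rw [Finset.sum_mul]
    exact Finset.sum_le_sum fun j _ => min_le_right _ _
  have h3 : D ^ (2 : ℝ) ≤ D ^ (2 * ν + 2) :=
    Real.rpow_le_rpow_of_exponent_le h1.le (by linarith)
  rw [Real.rpow_two, sq] at h3
  exact le_of_mul_le_mul_right (h3.trans h2) hD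

/-- By the equation for `D`, the total weight is at least `D ^ (2 * ν + 2)`, and `D` is
comparable with `2 ^ L`. -/
theorem two_pow_resolution_sq_div_le (W : CDVBasis A) {ν d₀ D : ℝ} (hν : 0 < ν) (hd : 0 < d₀)
    (hdD : d₀ ≤ D) {m : ℕ} {n : Fin m → ℕ} {ε : Fin m → ℝ}
    (h : D ^ (2 * ν + 2) = ∑ j, min ((n j : ℝ) ^ 2 * ε j ^ 2) (n j * D)) :
    (2 ^ W.resolution D) ^ 2 / ∑ j, rawWeight (W.resolution D) (n j) (ε j) ≤
      min (d₀ / 2 ^ (W.l₀ + 1)) (1 / 2) ^ (-(2 * ν + 2)) *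
        (((2 : ℝ) ^ (-ν)) ^ W.resolution D) ^ 2 := by
  have hD : 0 < D := hd.trans_le hdD
  have hκ : 0 < min (d₀ / 2 ^ (W.l₀ + 1)) (1 / 2) := by positivity
  have h1 := W.le_two_pow_resolution hD
  have h2 := W.two_pow_resolution_le hd hdD
  set κ := min (d₀ / 2 ^ (W.l₀ + 1)) (1 / 2)
  generalize W.resolution D = L at *
  have hV : (κ * 2 ^ L) ^ (2 * ν + 2) ≤ ∑ j, rawWeight L (n j) (ε j) := by
    calc _ ≤ D ^ (2 * ν + 2) := Real.rpow_le_rpow (by positivity) h2 (by linarith)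
      _ ≤ _ := by
        rw [h]
        exact Finset.sum_le_sum fun j _ => min_le_min_left _ (by gcongr)
  calc (2 ^ L) ^ 2 / ∑ j, rawWeight L (n j) (ε j) ≤ (2 ^ L) ^ 2 / (κ * 2 ^ L) ^ (2 * ν + 2) := by
        gcongr
    _ = _ := by
        rw [Real.mul_rpow hκ.le (by positivity), ← Real.rpow_natCast 2 L,
          ← Real.rpow_natCast ((2 : ℝ) ^ (-ν)) L, ← Real.rpow_mul (by norm_num),
          ← Real.rpow_mul (by norm_num), ← Real.rpow_two, ← Real.rpow_two,
          ← Real.rpow_mul (by norm_num), ← Real.rpow_mul (by norm_num), Real.rpow_neg hκ.le,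
          div_eq_mul_inv, mul_inv, mul_left_comm, ← Real.rpow_neg (by norm_num) (_ * _),
          ← Real.rpow_add (by norm_num)]
        congr 2
        ring

/-! ### The risk bound -/

theorem threshold_pos (W : CDVBasis A) {B ν : ℝ} (hB : 0 ≤ B) (hν : 0 < ν) (D : ℝ) :
    0 < threshold B ν (W.resolution D) := by
  have : (1 : ℝ) ≤ W.resolution D := by exact_mod_cast W.one_le_resolution D
  unfold threshold
  positivity

theorem zero_mem_besovBall (W : CDVBasis A) (α R : ℝ) {p q : ℝ≥0∞} (hp : 1 ≤ p) (hq : 1 ≤ q) :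
    (0 : I → ℝ) ∈ W.besovBall α p q R := by
  have : Fact (1 ≤ p) := ⟨hp⟩
  have hlev : ∀ l, W.levelNorm α p 0 l = 0 := by
    intro l
    have h0 : (fun k : Fin (W.width l) => W.coeff 0 l k) = 0 := by ext k; simp [coeff]
    rw [levelNorm, h0, WithLp.toLp_zero, norm_zero, mul_zero]
  refine ⟨MemLp.zero, ?_⟩
  have hn : W.besovNorm α p q 0 = 0 := by
    unfold besovNorm
    simp only [hlev, ENNReal.ofReal_zero]
    split_ifs with hq'
    · simp
    · have hpos : 0 < q.toReal := ENNReal.toReal_pos (by rintro rfl; simp at hq) hq'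
      simp [ENNReal.zero_rpow_of_pos hpos, hpos]
  rw [hn]
  exact zero_le

/-- The bias at the resolution `L`: clipping contributes `2 ^ L * exp (-(2 * ν + 1) * L)` and the
truncation of the wavelet series `2 ^ (-L * ν)`. -/
theorem abs_bias_le (W : CDVBasis A) {M : ℝ}
    (hM : ∀ (l : ℕ) (x : I),
      ∑ k ∈ Finset.range (W.width l), |W.fn l k x| ≤ M * (2 : ℝ) ^ ((l : ℝ) / 2))
    {α ν R B : ℝ} {p q : ℝ≥0∞} (hp : 1 ≤ p) (hq : 1 ≤ q) (hν : ν = α - (p⁻¹).toReal) (hν₀ : 0 < ν)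
    (hR : 0 ≤ R) {f : I → ℝ} (hf : f ∈ W.besovBall α p q R) (hfc : Continuous f)
    (hB : ∀ x, |f x| ≤ B) {L : ℕ} (hL : W.l₀ ≤ L) (hL₁ : 1 ≤ L) (x₀ : I) :
    |(∫ z, W.summand L (threshold B ν L) x₀ z ∂(regressionLaw f)) - f x₀| ≤
      (4 * M ^ 2 + R * M * (1 - (2 : ℝ) ^ (-ν))⁻¹) * ((2 : ℝ) ^ (-ν)) ^ L := by
  have hL' : (1 : ℝ) ≤ L := by exact_mod_cast hL₁
  have ht : 1 ≤ √(2 * (2 * ν + 1) * L) := Real.one_le_sqrt.2 (by nlinarith)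
  have h1 := W.abs_integral_summand_sub_le hM L ht x₀ hfc hB
  have hfs : f = W.series f := eq_of_ae_eq_of_continuous hfc
    (W.continuous_series hM hp hq hν hν₀ hR hf) (W.ae_eq_series hM hp hq hν hν₀ hR hf)
  have h2 := W.abs_sum_layer_sub_series_le hM hp hq hν hν₀ hR hf hL x₀
  rw [← hfs] at h2
  have hk : ∫ x, f x * W.kernel L x₀ x = ∑ l ∈ Finset.Icc W.l₀ L, W.layer f l x₀ :=
    W.integral_mul_kernel L x₀ (integrable_of_continuous hfc)
  rw [hk] at h1
  have hexp : Real.exp (-(√(2 * (2 * ν + 1) * L) ^ 2 / 2)) * 2 ^ L ≤ ((2 : ℝ) ^ (-ν)) ^ L := by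
    rw [Real.sq_sqrt (by positivity),
      show -(2 * (2 * ν + 1) * (L : ℝ) / 2) = L * (-(2 * ν + 1)) by ring, Real.exp_nat_mul,
      ← mul_pow]
    refine pow_le_pow_left₀ (by positivity) ?_ _
    have he : Real.exp (-(2 * ν + 1)) ≤ (2 : ℝ) ^ (-(2 * ν + 1)) := by
      rw [Real.rpow_def_of_pos (by norm_num)]
      refine Real.exp_le_exp.2 ?_
      nlinarith [Real.log_two_lt_d9]
    calc _ ≤ (2 : ℝ) ^ (-(2 * ν + 1)) * 2 := by gcongr
      _ = (2 : ℝ) ^ (-(2 * ν)) := by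
          rw [← Real.rpow_add_one (by norm_num)]; congr 1; ring
      _ ≤ (2 : ℝ) ^ (-ν) := Real.rpow_le_rpow_of_exponent_le (by norm_num) (by linarith)
  rw [threshold]
  refine (abs_sub_le _ _ _).trans ((add_le_add h1 h2).trans ?_)
  nlinarith [mul_le_mul_of_nonneg_left hexp (by positivity : 0 ≤ 4 * M ^ 2)]

theorem threshold_sq_le {B ν : ℝ} (hν : 0 < ν) {L : ℕ} (hL : 1 ≤ L) :
    threshold B ν L ^ 2 ≤ (2 * B ^ 2 + 4 * (2 * ν + 1)) * L := by
  have hL' : (1 : ℝ) ≤ L := by exact_mod_cast hL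
  have hs : √(2 * (2 * ν + 1) * L) ^ 2 = 2 * (2 * ν + 1) * L := Real.sq_sqrt (by positivity)
  rw [threshold]
  refine (add_sq_le).trans ?_
  rw [hs]
  nlinarith [mul_le_mul_of_nonneg_left hL' (sq_nonneg B)]

/-- The squared bias is of order `2 ^ (-2 * L * ν)` and the variance of order
`τ ^ 2 * 2 ^ (-2 * L * ν)`; the logarithm comes from `τ ^ 2 ≲ L ≲ log N`. -/
theorem exists_mse_le (W : CDVBasis A) {M : ℝ} (hM₀ : 0 < M)
    (hM : ∀ (l : ℕ) (x : I),
      ∑ k ∈ Finset.range (W.width l), |W.fn l k x| ≤ M * (2 : ℝ) ^ ((l : ℝ) / 2))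
    {α ν R B c d₀ : ℝ} {p q : ℝ≥0∞} (hp : 1 ≤ p) (hq : 1 ≤ q) (hν : ν = α - (p⁻¹).toReal)
    (hν₀ : 0 < ν) (hR : 0 < R) (hB₀ : 0 ≤ B) (hc : 0 < c) (hd₀ : 0 < d₀) :
    ∃ C : ℝ, 0 < C ∧ ∀ (x₀ : I) (m : ℕ) (n : Fin m → ℕ) (ε : Fin m → ℝ) (D : ℝ),
      (∀ j, 1 ≤ n j) → (∀ j, 0 < ε j) → 0 < D →
      D ^ (2 * ν + 2) = ∑ j, min ((n j : ℝ) ^ 2 * ε j ^ 2) (n j * D) →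
      2 ≤ ∑ j, n j → d₀ ≤ D → ∀ f ∈ W.besovBall α p q R, Continuous f → (∀ x, |f x| ≤ B) →
        W.mse c (W.resolution D) (threshold B ν (W.resolution D)) x₀ n ε f ≤
          ENNReal.ofReal (C * Real.log (∑ j, n j : ℕ) *
            (2 : ℝ) ^ (-(2 * (W.resolution D : ℝ) * ν))) := by
  have hr := two_rpow_neg_lt_one hν₀
  have hlog2 : 0 < Real.log 2 := Real.log_pos (by norm_num)
  -- `K₁` bounds the bias, `K₂` the constants in the variance, `κ` compares `D` with `2 ^ L`
  set K₁ := 4 * M ^ 2 + R * M * (1 - (2 : ℝ) ^ (-ν))⁻¹ with hK₁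
  set K₂ := (2 * M ^ 2 + 2 * c ^ 2) * (2 * B ^ 2 + 4 * (2 * ν + 1)) with hK₂
  set κ := min (d₀ / 2 ^ (W.l₀ + 1)) (1 / 2) with hκ
  have hκ₀ : 0 < κ := by positivity
  have hK₂₀ : 0 < K₂ := by positivity
  refine ⟨K₁ ^ 2 / Real.log 2 + K₂ * κ ^ (-(2 * ν + 2)) * ((W.l₀ + 3) / Real.log 2),
    by positivity, ?_⟩
  intro x₀ m n ε D hn hε hD hDeq hN hdD f hf hfc hfB
  have hN' : (2 : ℝ) ≤ ((∑ j, n j : ℕ) : ℝ) := by exact_mod_cast hN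
  have hLlog := W.resolution_le_mul_log hN' hD (le_sum_of_rpow_eq hν₀ hD hDeq hN)
  have hV := W.two_pow_resolution_sq_div_le hν₀ hd₀ hdD hDeq
  have hτ := W.threshold_pos hB₀ hν₀ D
  have hL₁ := W.one_le_resolution D
  have hbias := W.abs_bias_le hM hp hq hν hν₀ hR.le hf hfc hfB (W.le_resolution D) hL₁ x₀
  rw [← hK₁] at hbias
  rw [← hκ] at hV
  generalize W.resolution D = L at *
  have hτ2 := threshold_sq_le (B := B) hν₀ hL₁
  have hVpos : 0 < ∑ j, rawWeight L (n j) (ε j) := by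
    refine Finset.sum_pos (fun j _ => rawWeight_pos L (hn j) (hε j)) ?_
    by_contra he
    rw [Finset.not_nonempty_iff_eq_empty.1 he, Finset.sum_empty] at hN
    omega
  have hu : ∑ j, weight L n ε j = 1 := by
    simp only [weight]
    rw [← Finset.sum_div, div_self hVpos.ne']
  refine (W.mse_le hM hc hτ L x₀ hn hε hu hfc.measurable).trans (ENNReal.ofReal_le_ofReal ?_)
  have hlogN : 1 ≤ Real.log (∑ j, n j : ℕ) / Real.log 2 := by
    rw [one_le_div hlog2]
    exact Real.log_le_log (by norm_num) hN'
  have hrate : (2 : ℝ) ^ (-(2 * (L : ℝ) * ν)) = (((2 : ℝ) ^ (-ν)) ^ L) ^ 2 := by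
    rw [← pow_mul, ← Real.rpow_natCast, ← Real.rpow_mul (by norm_num)]
    congr 1; push_cast; ring
  rw [hrate]
  set ρ := (((2 : ℝ) ^ (-ν)) ^ L) ^ 2 with hρ
  have hρ₀ : 0 ≤ ρ := by positivity
  set lN := Real.log (∑ j, n j : ℕ)
  have h1 : ((∫ z, W.summand L (threshold B ν L) x₀ z ∂(regressionLaw f)) - f x₀) ^ 2 ≤
      K₁ ^ 2 * ρ * (lN / Real.log 2) := by
    calc _ = |(∫ z, W.summand L (threshold B ν L) x₀ z ∂(regressionLaw f)) - f x₀| ^ 2 :=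
          (sq_abs _).symm
      _ ≤ (K₁ * ((2 : ℝ) ^ (-ν)) ^ L) ^ 2 := pow_le_pow_left₀ (abs_nonneg _) hbias 2
      _ = K₁ ^ 2 * ρ := by rw [mul_pow]
      _ ≤ _ := le_mul_of_one_le_right (by positivity) hlogN
  have h2 := sum_weight_sq_mul_le (M := M) (c := c) (τ := threshold B ν L) L hn hε
  have h3 : (2 * M ^ 2 + 2 * c ^ 2) * threshold B ν L ^ 2 * (2 ^ L) ^ 2 /
      ∑ j, rawWeight L (n j) (ε j) ≤
      K₂ * κ ^ (-(2 * ν + 2)) * ((W.l₀ + 3) / Real.log 2) * lN * ρ := by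
    calc _ = (2 * M ^ 2 + 2 * c ^ 2) * threshold B ν L ^ 2 *
          ((2 ^ L) ^ 2 / ∑ j, rawWeight L (n j) (ε j)) := by rw [mul_div_assoc]
      _ ≤ (2 * M ^ 2 + 2 * c ^ 2) * ((2 * B ^ 2 + 4 * (2 * ν + 1)) *
            ((W.l₀ + 3) / Real.log 2 * lN)) * (κ ^ (-(2 * ν + 2)) * ρ) := by
          refine mul_le_mul (mul_le_mul_of_nonneg_left (hτ2.trans ?_) (by positivity)) hV
            (by positivity) ?_
          · exact mul_le_mul_of_nonneg_left hLlog (by positivity)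
          · have : (0 : ℝ) ≤ L := Nat.cast_nonneg _
            have := this.trans hLlog
            positivity
      _ = _ := by rw [hK₂]; ring
  refine (add_le_add h1 (h2.trans h3)).trans_eq ?_
  ring

end CDVBasis

end FedWavelet

end

theorem mainTheorem3 {A : ℕ} (W : FedWavelet.CDVBasis A) :
    ∃ c₀ : ℝ, 0 < c₀ ∧
    ∀ (α ν R : ℝ) (p q : ℝ≥0∞), 2 ≤ p → 1 ≤ q → ν = α - (p⁻¹).toReal → 1 / 2 < ν → α < A → 0 < R →
      -- every element of the ball has a continuous version, with a uniform bound
      (∃ B : ℝ, ∀ f ∈ W.besovBall α p q R,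
        ∃ g : I → ℝ, Continuous g ∧ f =ᵐ[volume] g ∧ ∀ x, |g x| ≤ B) ∧
      -- `B` is any uniform bound on the ball, `c` any large enough noise constant
      ∀ B : ℝ, (∀ f ∈ W.besovBall α p q R, ∀ᵐ x, |f x| ≤ B) → ∀ c : ℝ, c₀ ≤ c →
        ∀ d₀ : ℝ, 0 < d₀ → ∃ C : ℝ, 0 < C ∧
          ∀ (x₀ : I), 0 < x₀ → x₀ < 1 →
          ∀ (m : ℕ) (n : Fin m → ℕ) (ε : Fin m → ℝ) (D : ℝ),
            (∀ j, 1 ≤ n j) → (∀ j, 0 < ε j) → 0 < D →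
            D ^ (2 * ν + 2) = ∑ j, min ((n j : ℝ) ^ 2 * ε j ^ 2) (n j * D) →
            ∀ (L : ℕ) (τ : ℝ), L = W.resolution D → τ = FedWavelet.CDVBasis.threshold B ν L →
              -- the protocol is differentially private, also with all `δ j = 0`
              (∀ δ : Fin m → ℝ, (∀ j, 0 ≤ δ j) → ∀ j : Fin m,
                FedWavelet.IsDP (fun z : Fin (n j) → FedWavelet.Obs =>
                  W.transcriptLaw c L τ x₀ (ε j) z) (ε j) (δ j)) ∧
              -- the worst case risk
              (2 ≤ ∑ j, n j → d₀ ≤ D →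
                ⨆ f ∈ {f ∈ W.besovBall α p q R | Continuous f}, W.mse c L τ x₀ n ε f ≤
                  ENNReal.ofReal (C * Real.log (∑ j, n j : ℕ) *
                    (2 : ℝ) ^ (-(2 * (L : ℝ) * ν)))) := by
  obtain ⟨M, hM₀, hM⟩ := W.exists_sum_abs_fn_le
  refine ⟨4 * M ^ 2, by positivity, ?_⟩
  intro α ν R p q hp hq hν hν₂ _ hR
  have hν₀ : 0 < ν := by linarith
  have hp1 : 1 ≤ p := one_le_two.trans hp
  refine ⟨⟨R * M * ((2 : ℝ) ^ (-ν)) ^ W.l₀ * (1 - (2 : ℝ) ^ (-ν))⁻¹, fun f hf =>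
    ⟨W.series f, W.continuous_series hM hp1 hq hν hν₀ hR.le hf,
      W.ae_eq_series hM hp1 hq hν hν₀ hR.le hf,
      W.abs_series_le hM hp1 hq hν hν₀ hR.le hf⟩⟩, ?_⟩
  intro B hB c hc d₀ hd₀
  -- the zero function lies in the ball, so a bound on the ball is non-negative
  have hB₀ : 0 ≤ B := by
    obtain ⟨x, hx⟩ := (hB 0 (W.zero_mem_besovBall α R hp1 hq)).exists
    exact (abs_nonneg _).trans hx
  have hc₀ : 0 < c := lt_of_lt_of_le (by positivity) hc
  obtain ⟨C, hC₀, hC⟩ := W.exists_mse_le hM₀ hM (α := α) hp1 hq hν hν₀ hR hB₀ hc₀ hd₀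
  refine ⟨C, hC₀, ?_⟩
  intro x₀ _ _ m n ε D hn hε hD hDeq L τ hL hτ
  have hτ₀ : 0 < τ := hτ ▸ hL ▸ FedWavelet.CDVBasis.threshold_pos W hB₀ hν₀ D
  refine ⟨fun δ _ j => W.isDP_transcriptLaw hM hc₀ hc hτ₀ L x₀ (hn j) (hε j) (δ j), ?_⟩
  intro hN hdD
  refine iSup₂_le fun f hf => ?_
  subst hL hτ
  exact hC x₀ m n ε D hn hε hD hDeq hN hdD f hf.1 hf.2
    (FedWavelet.abs_le_of_ae_abs_le hf.2 (hB f hf.1))
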